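/- Let $n\ge 1$, let $1\le s_j<q_j\le\infty$ for $1\le j\le n$, and define $q\in(0,\infty]$ by $\frac1q=\frac1{q_1}+\dots+\frac1{q_n}$ (with $\frac1\infty=0$). For measurable functions $f_1,\dots,f_n$ on $\mathbb R$ let $$\vec{\mathcal M}_{s_1,\dots,s_n}(f_1,\dots,f_n)(x)=\sup_{Q\ni x}\ \prod_{j=1}^n\Big(\frac1{|Q|}\int_Q|f_j(y)|^{s_j}\,dy\Big)^{1/s_j},$$ where the supremum is over all bounded open intervals $Q\subset\mathbb R$ that contain $x$ (and $0\cdot\infty=0$). Let $\vec w=(w_1,\dots,w_n)$ be a vector of weights on $\mathbb R$, that is, of locally integrable functions that are positive almost everywhere, with $w_j\equiv 1$ whenever $q_j=\infty$, and put $\nu_{\vec w}=\prod_{j=1}^n w_j^{q/q_j}$, where the factors with $q_j=\infty$ are equal to $1$. Then there is a constant $C<\infty$ (which may depend on $n$, $s_j$, $q_j$ and $\vec w$, but not on the functions) such that $$\big\|\vec{\mathcal M}_{s_1,\dots,s_n}(f_1,\dots,f_n)\big\|_{L^q(\nu_{\vec w})}\le C\prod_{j=1}^n\|f_j\|_{L^{q_j}(w_j)}$$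 for all measurable functions $f_1,\dots,f_n$ on $\mathbb R$ if and only if $\vec w$ satisfies the $A_{\vec q,\vec s}$ condition $$\sup_{Q}\Big(\frac1{|Q|}\int_Q\nu_{\vec w}\Big)^{1/q}\prod_{j=1}^n\Big(\frac1{|Q|}\int_Q w_j^{-\frac{s_j}{q_j-s_j}}\Big)^{\frac1{s_j}-\frac1{q_j}}<\infty,$$ the supremum being over all bounded nondegenerate intervals $Q\subset\mathbb R$. Here $L^p(w)$ denotes the Lebesgue space $L^p(\mathbb R, w\,dx)$ (quasi-normed if $p<1$), and for $q_j=\infty$ one reads $\frac{s_j}{q_j-s_j}=0$. -/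

import Mathlib

open MeasureTheory
open scoped NNReal ENNReal

/-- A weight on the real line: a locally integrable function that is positive almost everywhere. -/
def IsWeight (w : ℝ → ℝ) : Prop :=
  LocallyIntegrable w volume ∧ ∀ᵐ x ∂(volume : Measure ℝ), 0 < w x

/-- The measure `w dx` on the real line. -/
noncomputable def weightMeasure (w : ℝ → ℝ) : Measure ℝ :=
  volume.withDensity (fun x => ENNReal.ofReal (w x))

/-- The multi-(sub)linear maximal operator
`M(f₁, …, fₙ)(x) = sup_{Q ∋ x} ∏ⱼ (|Q|⁻¹ ∫_Q |fⱼ|^{sⱼ})^{1/sⱼ}`, the supremum being over all bounded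
open intervals `Q = (a, b)` that contain `x`. -/
noncomputable def multiMaximal {n : ℕ} (s : Fin n → ℝ≥0) (f : Fin n → ℝ → ℂ) (x : ℝ) : ℝ≥0∞ :=
  ⨆ (a : ℝ) (b : ℝ) (_ : x ∈ Set.Ioo a b),
    ∏ j, (⨍⁻ y in Set.Ioo a b, ‖f j y‖ₑ ^ (s j : ℝ) ∂volume) ^ (1 / (s j : ℝ))

/-- The product weight `ν = ∏ⱼ wⱼ^{q/qⱼ}`; here `q₀` is the target exponent `q`. The extended
quotient `q₀ / q j` is `0` when `q j = ∞`. -/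
noncomputable def productWeight {n : ℕ} (q : Fin n → ℝ≥0∞) (q₀ : ℝ≥0∞) (w : Fin n → ℝ → ℝ)
    (x : ℝ) : ℝ :=
  ∏ j, w j x ^ (q₀ / q j).toReal

/-- The characteristic
`sup_Q (⨍_Q ν)^{1/q} ∏ⱼ (⨍_Q wⱼ^{-sⱼ/(qⱼ-sⱼ)})^{1/sⱼ-1/qⱼ}` of a vector weight, the supremum being
over all bounded intervals. The exponents are computed in `[0, ∞]`, so that `1/q = 0` for `q = ∞`
and `sⱼ/(qⱼ-sⱼ) = 0` for `qⱼ = ∞`. -/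
noncomputable def vectorWeightConst {n : ℕ} (s : Fin n → ℝ≥0) (q : Fin n → ℝ≥0∞) (q₀ : ℝ≥0∞)
    (w : Fin n → ℝ → ℝ) : ℝ≥0∞ :=
  ⨆ (a : ℝ) (b : ℝ) (_ : a < b),
    (⨍⁻ x in Set.Ioo a b, ENNReal.ofReal (productWeight q q₀ w x) ∂volume) ^ (q₀⁻¹).toReal *
      ∏ j, (⨍⁻ x in Set.Ioo a b,
          ENNReal.ofReal (w j x ^ (-((s j : ℝ≥0∞) / (q j - (s j : ℝ≥0∞))).toReal)) ∂volume)
        ^ (1 / (s j : ℝ) - ((q j)⁻¹).toReal)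

/-- The vector weight condition `A_{q⃗, s⃗}`. -/
def IsVectorWeightClass {n : ℕ} (s : Fin n → ℝ≥0) (q : Fin n → ℝ≥0∞) (q₀ : ℝ≥0∞)
    (w : Fin n → ℝ → ℝ) : Prop :=
  vectorWeightConst s q q₀ w < ∞

/-! Write `S = 1/s`, `r = 1/q` for each index, `R = ∑ r`, and `g = |f|^s`. Let `σ` be the dual
weights and `ν` the product weight; on an interval `Q` let `V` and `A` be their averages.
Sufficiency rests on a feature of the line: the uncentered maximal operator of any s-finite measure
`μ` is bounded on `L^p(μ)` for `p > 1`, with a constant independent of `μ`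
(`exists_lintegral_intervalMaximal_rpow_le`). No doubling or `A_∞` theory is needed. On `Q`, the
average of `g` is `A` times the `σ`-average of `g/σ`, hence at most `A` times a maximal function at
any point of `Q`. To control `∏ A^S`, raise the weight condition to a large power `γ` with `γ(S - r)
≥ S`. The surplus powers of `A` are then nonnegative, and Hölder's inequality trades them for the
average of a product of negative powers of the `σ`. What results is a `ν`-average of one auxiliary
function, so the multilinear maximal function is dominated by a power of a `ν`-maximal function
(`prod_laverage_rpow_le_intervalMaximal`). The maximal theorem in `L^γ(ν)`, Hölder with exponents
`r/R`, and the maximal theorem in each `L^{S/r}(σ)` finish the bound, also for `q < 1`. For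
necessity, test on `σ` truncated and restricted to `Q` (`weightCharacteristic_le_of_maximal_le`). -/

/-! ### The maximal theorem on the line for arbitrary measures. -/

open Set in
theorem isOpen_setOf_lt_iSup_Ioo (F : ℝ → ℝ → ℝ≥0∞) (t : ℝ≥0∞) :
    IsOpen {x : ℝ | t < ⨆ (a : ℝ) (b : ℝ) (_ : x ∈ Set.Ioo a b), F a b} := by
  have : {x : ℝ | t < ⨆ (a : ℝ) (b : ℝ) (_ : x ∈ Set.Ioo a b), F a b} =
      ⋃ (a : ℝ) (b : ℝ) (_ : t < F a b), Set.Ioo a b := by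
    ext x
    simp only [lt_iSup_iff, mem_ofPred_eq, mem_iUnion, exists_prop]
    simp only [and_comm]
  rw [this]
  exact isOpen_iUnion fun a => isOpen_iUnion fun b => isOpen_iUnion fun _ => isOpen_Ioo

/-- Superlevel sets are unions of open intervals, so no regularity of `F` in the endpoints is
needed. -/
theorem measurable_iSup_Ioo (F : ℝ → ℝ → ℝ≥0∞) :
    Measurable fun x : ℝ => ⨆ (a : ℝ) (b : ℝ) (_ : x ∈ Set.Ioo a b), F a b :=
  measurable_of_Ioi fun t => (isOpen_setOf_lt_iSup_Ioo F t).measurableSet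

/-- The uncentered maximal function with respect to the measure `μ` on the real line. -/
noncomputable def intervalMaximal (μ : Measure ℝ) (h : ℝ → ℝ≥0∞) (x : ℝ) : ℝ≥0∞ :=
  ⨆ (a : ℝ) (b : ℝ) (_ : x ∈ Set.Ioo a b), ⨍⁻ y in Set.Ioo a b, h y ∂μ

theorem measurable_intervalMaximal (μ : Measure ℝ) (h : ℝ → ℝ≥0∞) :
    Measurable (intervalMaximal μ h) :=
  measurable_iSup_Ioo _

theorem laverage_le_intervalMaximal (μ : Measure ℝ) (h : ℝ → ℝ≥0∞) {a b x : ℝ}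
    (hx : x ∈ Set.Ioo a b) : ⨍⁻ y in Set.Ioo a b, h y ∂μ ≤ intervalMaximal μ h x :=
  le_iSup_of_le a (le_iSup_of_le b (le_iSup_of_le hx le_rfl))

/-- A finite family of open intervals has a subfamily with the same union and overlap at most two. -/
theorem exists_subfamily_overlap_le_two (T : Finset (ℝ × ℝ)) :
    ∃ T' ⊆ T, (⋃ p ∈ T', Set.Ioo p.1 p.2) = (⋃ p ∈ T, Set.Ioo p.1 p.2) ∧
      ∀ x, (T'.filter fun p => x ∈ Set.Ioo p.1 p.2).card ≤ 2 := by
  classical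
  let S := T.powerset.filter fun T' => (⋃ p ∈ T', Set.Ioo p.1 p.2) = (⋃ p ∈ T, Set.Ioo p.1 p.2)
  have hS : S.Nonempty := ⟨T, by simp [S]⟩
  -- A subfamily of minimal cardinality contains no redundant interval.
  obtain ⟨T', hT', hmin⟩ := Finset.exists_min_image S Finset.card hS
  simp only [S, Finset.mem_filter, Finset.mem_powerset] at hT' hmin
  refine ⟨T', hT'.1, hT'.2, fun x => ?_⟩
  by_contra! hx
  set G := T'.filter fun p => x ∈ Set.Ioo p.1 p.2 with hG
  have hGne : G.Nonempty := Finset.card_pos.1 (by omega)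
  -- Among intervals through `x`, the one reaching furthest left and the one reaching furthest right
  -- cover all the others, so a third could be erased.
  obtain ⟨l, hl, hl'⟩ := Finset.exists_min_image G Prod.fst hGne
  obtain ⟨u, hu, hu'⟩ := Finset.exists_max_image G Prod.snd hGne
  obtain ⟨m, hm, hmn⟩ : ∃ m ∈ G, m ∉ ({l, u} : Finset (ℝ × ℝ)) := by
    by_contra! hc
    have := Finset.card_le_card (show G ⊆ {l, u} from hc)
    have := Finset.card_le_two (a := l) (b := u)
    omega
  simp only [Finset.mem_insert, Finset.mem_singleton, not_or] at hmn
  have hGm : ∀ p ∈ G, p ∈ T' ∧ p.1 < x ∧ x < p.2 := fun p hp => by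
    simpa [hG] using hp
  have hcov : (⋃ p ∈ T'.erase m, Set.Ioo p.1 p.2) = (⋃ p ∈ T', Set.Ioo p.1 p.2) := by
    apply subset_antisymm
    · exact Set.biUnion_subset_biUnion_left (Finset.erase_subset _ _)
    · intro y hy
      simp only [Set.mem_iUnion, exists_prop] at hy ⊢
      obtain ⟨p, hp, hy⟩ := hy
      by_cases hpm : p = m
      · subst hpm
        rcases le_or_gt y x with hyx | hyx
        · exact ⟨l, Finset.mem_erase.2 ⟨Ne.symm hmn.1, (hGm l hl).1⟩,
            (hl' p hm).trans_lt hy.1, hyx.trans_lt (hGm l hl).2.2⟩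
        · exact ⟨u, Finset.mem_erase.2 ⟨Ne.symm hmn.2, (hGm u hu).1⟩,
            (hGm u hu).2.1.trans hyx, hy.2.trans_le (hu' p hm)⟩
      · exact ⟨p, Finset.mem_erase.2 ⟨hpm, hp⟩, hy⟩
  have h1 := hmin (T'.erase m) ⟨(Finset.erase_subset _ _).trans hT'.1, hcov.trans hT'.2⟩
  have h2 := Finset.card_erase_lt_of_mem (hGm m hm).1
  omega

theorem mul_measure_biUnion_Ioo_le (μ : Measure ℝ) {h : ℝ → ℝ≥0∞} (hh : Measurable h) (t : ℝ≥0∞)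
    (T : Finset (ℝ × ℝ))
    (hT : ∀ p ∈ T, t * μ (Set.Ioo p.1 p.2) ≤ ∫⁻ y in Set.Ioo p.1 p.2, h y ∂μ) :
    t * μ (⋃ p ∈ T, Set.Ioo p.1 p.2) ≤ 2 * ∫⁻ y, h y ∂μ := by
  classical
  obtain ⟨T', hsub, hU, hov⟩ := exists_subfamily_overlap_le_two T
  rw [← hU]
  calc t * μ (⋃ p ∈ T', Set.Ioo p.1 p.2)
      ≤ t * ∑ p ∈ T', μ (Set.Ioo p.1 p.2) := by
        gcongr
        exact measure_biUnion_finset_le _ _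
    _ ≤ ∑ p ∈ T', ∫⁻ y, (Set.Ioo p.1 p.2).indicator h y ∂μ := by
        rw [Finset.mul_sum]
        refine Finset.sum_le_sum fun p hp => ?_
        rw [lintegral_indicator measurableSet_Ioo]
        exact hT p (hsub hp)
    _ = ∫⁻ y, ∑ p ∈ T', (Set.Ioo p.1 p.2).indicator h y ∂μ :=
        (lintegral_finsetSum _ fun p _ => hh.indicator measurableSet_Ioo).symm
    _ ≤ ∫⁻ y, 2 * h y ∂μ := by
        refine lintegral_mono fun y => ?_
        simp only [Set.indicator_apply]
        rw [← Finset.sum_filter, Finset.sum_const, nsmul_eq_mul]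
        gcongr
        exact_mod_cast hov y
    _ = 2 * ∫⁻ y, h y ∂μ := lintegral_const_mul _ hh

/-- The superlevel set is a union of intervals with large average. Lindelöf makes the union
countable, and continuity from below reduces it to finite unions, where overlap two gives the
constant. -/
theorem mul_measure_lt_intervalMaximal_le (μ : Measure ℝ) {h : ℝ → ℝ≥0∞} (hh : Measurable h)
    (t : ℝ≥0∞) : t * μ {x | t < intervalMaximal μ h x} ≤ 2 * ∫⁻ y, h y ∂μ := by
  classical
  have key : ∀ a b : ℝ, t < ⨍⁻ y in Set.Ioo a b, h y ∂μ →
      t * μ (Set.Ioo a b) ≤ ∫⁻ y in Set.Ioo a b, h y ∂μ := by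
    intro a b hab
    rw [setLAverage_eq] at hab
    exact ENNReal.mul_le_of_le_div hab.le
  let I : Set (ℝ × ℝ) := {p | t < ⨍⁻ y in Set.Ioo p.1 p.2, h y ∂μ}
  have hset : {x | t < intervalMaximal μ h x} = ⋃ p ∈ I, Set.Ioo p.1 p.2 := by
    ext x
    simp only [intervalMaximal, lt_iSup_iff, Set.mem_ofPred_eq, Set.mem_iUnion, exists_prop,
      Prod.exists, I]
    simp only [and_comm]
  obtain ⟨J, hJI, hJc, hJ⟩ :=
    TopologicalSpace.isOpen_biUnion_countable I (fun p => Set.Ioo p.1 p.2) fun p _ => isOpen_Ioo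
  have := hJc.to_subtype
  rw [hset, ← hJ, Set.biUnion_eq_iUnion, Set.iUnion_eq_iUnion_finset,
    Directed.measure_iUnion, ENNReal.mul_iSup]
  · refine iSup_le fun F => ?_
    have h3 := mul_measure_biUnion_Ioo_le μ hh t (F.image Subtype.val) (by
      intro p hp
      obtain ⟨q, -, rfl⟩ := Finset.mem_image.1 hp
      exact key _ _ (hJI q.2))
    simpa [Finset.set_biUnion_finset_image] using h3
  · exact directed_of_isDirected_le fun F G hFG =>
      Set.biUnion_subset_biUnion_left fun _ hx => Finset.mem_of_subset hFG hx

theorem intervalMaximal_le_add (μ : Measure ℝ) (h : ℝ → ℝ≥0∞) (c : ℝ≥0∞) (x : ℝ) :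
    intervalMaximal μ h x ≤ c + intervalMaximal μ ({y | c < h y}.indicator h) x := by
  refine iSup_le fun a => iSup_le fun b => iSup_le fun hx => ?_
  calc ⨍⁻ y in Set.Ioo a b, h y ∂μ ≤ ⨍⁻ y in Set.Ioo a b, (c + {y | c < h y}.indicator h y) ∂μ := by
        refine laverage_mono_ae (Filter.Eventually.of_forall fun y => ?_)
        by_cases hy : c < h y
        · simp [hy]
        · simpa [Set.indicator_apply, hy] using not_lt.1 hy
    _ = ⨍⁻ y in Set.Ioo a b, c ∂μ + ⨍⁻ y in Set.Ioo a b, {y | c < h y}.indicator h y ∂μ := by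
        simp only [laverage_eq']
        exact lintegral_add_left measurable_const _
    _ ≤ _ := by
        gcongr
        · exact (laverage_le_essSup _).trans (essSup_le_of_ae_le _ (by simp [Filter.EventuallyLE]))
        · exact laverage_le_intervalMaximal μ _ hx

/-- The part of `h` below `t/2` adds at most `t/2` to the maximal function, so the weak-type bound
is needed only for the rest, at height `t/2`. -/
theorem mul_measure_lt_intervalMaximal_le_lintegral_indicator (μ : Measure ℝ) {h : ℝ → ℝ≥0∞}
    (hh : Measurable h) (t : ℝ≥0∞) :
    t * μ {x | t < intervalMaximal μ h x} ≤ 4 * ∫⁻ y, {y | t < 2 * h y}.indicator h y ∂μ := by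
  have hset : {y | t < 2 * h y} = {y | t / 2 < h y} := by
    ext y
    simp only [Set.mem_ofPred_eq]
    rw [ENNReal.div_lt_iff (by simp) (by simp), mul_comm]
  have h1 : {x | t < intervalMaximal μ h x} ⊆
      {x | t / 2 < intervalMaximal μ ({y | t / 2 < h y}.indicator h) x} := by
    intro x hx
    have h2 := lt_of_lt_of_le hx (intervalMaximal_le_add μ h (t / 2) x)
    by_contra hc
    simp only [Set.mem_ofPred_eq, not_lt] at hc
    exact absurd (h2.trans_le ((add_le_add_right hc _).trans (ENNReal.add_halves t).le)) (lt_irrefl _)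
  have h3 := mul_measure_lt_intervalMaximal_le μ
    (hh.indicator (measurableSet_lt (measurable_const (a := t / 2)) hh)) (t / 2)
  rw [hset]
  calc t * μ {x | t < intervalMaximal μ h x}
      ≤ t * μ {x | t / 2 < intervalMaximal μ ({y | t / 2 < h y}.indicator h) x} := by gcongr
    _ = 2 * (t / 2 * μ {x | t / 2 < intervalMaximal μ ({y | t / 2 < h y}.indicator h) x}) := by
        rw [← mul_assoc, ENNReal.mul_div_cancel (by simp) (by simp)]
    _ ≤ 2 * (2 * ∫⁻ y, {y | t / 2 < h y}.indicator h y ∂μ) := by gcongr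
    _ = _ := by rw [← mul_assoc]; norm_num

theorem lintegral_Ioo_zero_rpow {c : ℝ} (hc : 0 < c) {Y : ℝ} (hY : 0 ≤ Y) :
    ∫⁻ t in Set.Ioo 0 Y, ENNReal.ofReal (t ^ (c - 1)) = ENNReal.ofReal (Y ^ c / c) := by
  have h1 : IntervalIntegrable (fun t : ℝ => t ^ (c - 1)) volume 0 Y :=
    intervalIntegral.intervalIntegrable_rpow' (by linarith)
  have h2 := integral_rpow (a := 0) (b := Y) (r := c - 1) (Or.inl (by linarith))
  rw [sub_add_cancel, Real.zero_rpow hc.ne', sub_zero, intervalIntegral.integral_of_le hY] at h2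
  rw [← h2, ofReal_integral_eq_lintegral_ofReal
    ((intervalIntegrable_iff_integrableOn_Ioc_of_le hY).1 h1)
    ((ae_restrict_iff' measurableSet_Ioc).2
      (Filter.Eventually.of_forall fun t ht => Real.rpow_nonneg ht.1.le _)),
    restrict_Ioo_eq_restrict_Ioc]

theorem lintegral_Ioi_ite_rpow {c : ℝ} (hc : 0 < c) (y : ℝ≥0∞) :
    ∫⁻ t in Set.Ioi (0 : ℝ), (if ENNReal.ofReal t < y then
      ENNReal.ofReal (t ^ (c - 1)) else 0) = (ENNReal.ofReal c)⁻¹ * y ^ c := by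
  have hcc : ENNReal.ofReal c ≠ 0 := by simpa using hc
  have key : ∀ Y : ℝ, 0 ≤ Y → ∫⁻ t in Set.Ioo 0 Y, ENNReal.ofReal (t ^ (c - 1)) =
      (ENNReal.ofReal c)⁻¹ * (ENNReal.ofReal Y) ^ c := fun Y hY => by
    rw [lintegral_Ioo_zero_rpow hc hY, ENNReal.ofReal_div_of_pos hc,
      ENNReal.ofReal_rpow_of_nonneg hY hc.le, ENNReal.div_eq_inv_mul]
  induction y with
  | top =>
    rw [ENNReal.top_rpow_of_pos hc, ENNReal.mul_top (by simp)]
    refine ENNReal.eq_top_of_forall_nnreal_le fun R => ?_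
    -- This endpoint makes the truncated integral equal to `R`.
    have h1 := key ((c * R) ^ c⁻¹) (by positivity)
    rw [ENNReal.ofReal_rpow_of_nonneg (by positivity) hc.le, ← Real.rpow_mul (by positivity),
      inv_mul_cancel₀ hc.ne', Real.rpow_one, ENNReal.ofReal_mul hc.le, ← mul_assoc,
      ENNReal.inv_mul_cancel hcc (by simp), one_mul, ENNReal.ofReal_coe_nnreal] at h1
    rw [← h1]
    simp only [ENNReal.ofReal_lt_top, if_true]
    exact lintegral_mono_set Set.Ioo_subset_Ioi_self
  | coe y =>
    rw [← ENNReal.ofReal_coe_nnreal, ← key (y : ℝ) y.2]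
    have hm : MeasurableSet {t : ℝ | ENNReal.ofReal t < ENNReal.ofReal y} :=
      measurableSet_lt ENNReal.measurable_ofReal measurable_const
    have e : ∀ t : ℝ, (if ENNReal.ofReal t < ENNReal.ofReal y then
        ENNReal.ofReal (t ^ (c - 1)) else 0) = {t : ℝ | ENNReal.ofReal t <
        ENNReal.ofReal y}.indicator (fun t => ENNReal.ofReal (t ^ (c - 1))) t := fun t => by
      simp [Set.indicator_apply]
    simp_rw [e]
    rw [lintegral_indicator hm, Measure.restrict_restrict hm]
    congr 2
    ext t
    simp only [Set.mem_inter_iff, Set.mem_ofPred_eq, Set.mem_Ioi, Set.mem_Ioo]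
    constructor
    · rintro ⟨h1, h2⟩
      exact ⟨h2, (ENNReal.ofReal_lt_ofReal_iff_of_nonneg h2.le).1 h1⟩
    · rintro ⟨h1, h2⟩
      exact ⟨(ENNReal.ofReal_lt_ofReal_iff_of_nonneg h1.le).2 h2, h1⟩

/-- The truncated weak-type bound multiplied by `t^{p-2}`, in the form to be integrated over `t`. -/
theorem lintegral_ite_lt_intervalMaximal_le (μ : Measure ℝ) {h : ℝ → ℝ≥0∞} (hh : Measurable h)
    (p : ℝ) {t : ℝ} (ht : 0 < t) :
    ∫⁻ x, (if ENNReal.ofReal t < intervalMaximal μ h x then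
      ENNReal.ofReal (t ^ (p - 1)) else 0) ∂μ ≤
    4 * ∫⁻ x, h x * (if ENNReal.ofReal t < 2 * h x then
      ENNReal.ofReal (t ^ (p - 1 - 1)) else 0) ∂μ := by
  have hset : MeasurableSet {x | ENNReal.ofReal t < intervalMaximal μ h x} :=
    measurableSet_lt measurable_const (measurable_intervalMaximal μ h)
  have hset2 : MeasurableSet {x | ENNReal.ofReal t < 2 * h x} :=
    measurableSet_lt measurable_const (by fun_prop)
  have e1 : ∀ x, (if ENNReal.ofReal t < intervalMaximal μ h x then
      ENNReal.ofReal (t ^ (p - 1)) else 0) =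
      {x | ENNReal.ofReal t < intervalMaximal μ h x}.indicator
        (fun _ => ENNReal.ofReal (t ^ (p - 1))) x := fun x => by
    simp [Set.indicator_apply]
  have e2 : ∀ x, h x * (if ENNReal.ofReal t < 2 * h x then
      ENNReal.ofReal (t ^ (p - 1 - 1)) else 0) = ENNReal.ofReal (t ^ (p - 1 - 1)) *
      {x | ENNReal.ofReal t < 2 * h x}.indicator h x := fun x => by
    simp [Set.indicator_apply, mul_comm]
  simp_rw [e1, e2]
  rw [lintegral_indicator_const hset, lintegral_const_mul _ (hh.indicator hset2)]
  have e3 : t ^ (p - 1) = t ^ (p - 1 - 1) * t := by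
    rw [Real.rpow_sub_one ht.ne' (p - 1)]
    field_simp
  rw [e3, ENNReal.ofReal_mul (by positivity), mul_assoc, mul_left_comm 4]
  refine mul_le_mul_right ?_ _
  exact mul_measure_lt_intervalMaximal_le_lintegral_indicator μ hh _

theorem measurable_ite_ofReal_lt {u : ℝ → ℝ≥0∞} (hu : Measurable u) (c : ℝ) :
    Measurable fun z : ℝ × ℝ => if ENNReal.ofReal z.2 < u z.1 then ENNReal.ofReal (z.2 ^ c)
      else 0 :=
  Measurable.ite (measurableSet_lt (by fun_prop) (hu.comp measurable_fst)) (by fun_prop)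
    measurable_const

/-- The maximal theorem on the real line, for an arbitrary s-finite measure. -/
theorem exists_lintegral_intervalMaximal_rpow_le {p : ℝ} (hp : 1 < p) :
    ∃ C : ℝ≥0∞, C ≠ ∞ ∧ ∀ (μ : Measure ℝ) [SFinite μ] (h : ℝ → ℝ≥0∞), Measurable h →
      ∫⁻ x, intervalMaximal μ h x ^ p ∂μ ≤ C * ∫⁻ x, h x ^ p ∂μ := by
  have hp0 : 0 < p := by linarith
  have hp1 : 0 < p - 1 := by linarith
  have hpp : ENNReal.ofReal p ≠ 0 := by simpa using hp0
  -- The factor `p` comes from the layer-cake formula, `4` from the weak-type bound, and the rest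
  -- from integrating `t^{p-2}` up to `2h`.
  refine ⟨ENNReal.ofReal p * (4 * ((ENNReal.ofReal (p - 1))⁻¹ * 2 ^ (p - 1))), ?_, ?_⟩
  · have h1 : (ENNReal.ofReal (p - 1))⁻¹ ≠ ∞ := by simpa using hp
    have h2 : (2 : ℝ≥0∞) ^ (p - 1) ≠ ∞ := ENNReal.rpow_ne_top_of_nonneg hp1.le (by simp)
    exact ENNReal.mul_ne_top (by simp) (ENNReal.mul_ne_top (by simp) (ENNReal.mul_ne_top h1 h2))
  intro μ _ h hh
  let F : ℝ → ℝ → ℝ≥0∞ := fun x t => if ENNReal.ofReal t < intervalMaximal μ h x then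
    ENNReal.ofReal (t ^ (p - 1)) else 0
  let G : ℝ → ℝ → ℝ≥0∞ := fun x t => h x * (if ENNReal.ofReal t < 2 * h x then
    ENNReal.ofReal (t ^ (p - 1 - 1)) else 0)
  have hF : Measurable (Function.uncurry F) :=
    measurable_ite_ofReal_lt (measurable_intervalMaximal μ h) _
  have hG : Measurable (Function.uncurry G) :=
    (hh.comp measurable_fst).mul (measurable_ite_ofReal_lt (hh.const_mul 2) _)
  have hF1 : ∀ x, intervalMaximal μ h x ^ p =
      ENNReal.ofReal p * ∫⁻ t in Set.Ioi (0 : ℝ), F x t := fun x => by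
    rw [lintegral_Ioi_ite_rpow hp0, ← mul_assoc, ENNReal.mul_inv_cancel hpp (by simp), one_mul]
  have hG1 : ∀ x, ∫⁻ t in Set.Ioi (0 : ℝ), G x t =
      ((ENNReal.ofReal (p - 1))⁻¹ * 2 ^ (p - 1)) * h x ^ p := fun x => by
    have hm : Measurable fun t : ℝ => if ENNReal.ofReal t < 2 * h x then
        ENNReal.ofReal (t ^ (p - 1 - 1)) else 0 :=
      (measurable_ite_ofReal_lt (hh.const_mul 2) _).comp measurable_prodMk_left
    rw [lintegral_const_mul _ hm, lintegral_Ioi_ite_rpow hp1,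
      ENNReal.mul_rpow_of_nonneg _ _ hp1.le]
    have : h x ^ p = h x * h x ^ (p - 1) := by
      nth_rewrite 2 [← ENNReal.rpow_one (h x)]
      rw [← ENNReal.rpow_add_of_nonneg _ _ zero_le_one hp1.le]
      simp
    rw [this]
    ring
  have hG2 : Measurable fun t => ∫⁻ x, G x t ∂μ := hG.lintegral_prod_left'
  have hF2 : Measurable fun x => ∫⁻ t in Set.Ioi (0 : ℝ), F x t := hF.lintegral_prod_right'
  have hFG : ∫⁻ t in Set.Ioi (0 : ℝ), ∫⁻ x, F x t ∂μ ≤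
      ∫⁻ t in Set.Ioi (0 : ℝ), 4 * ∫⁻ x, G x t ∂μ :=
    setLIntegral_mono' measurableSet_Ioi fun t ht =>
      lintegral_ite_lt_intervalMaximal_le μ hh p ht
  calc ∫⁻ x, intervalMaximal μ h x ^ p ∂μ
      = ENNReal.ofReal p * ∫⁻ x, ∫⁻ t in Set.Ioi (0 : ℝ), F x t ∂volume ∂μ := by
        simp_rw [hF1]
        exact lintegral_const_mul _ hF2
    _ = ENNReal.ofReal p * ∫⁻ t in Set.Ioi (0 : ℝ), ∫⁻ x, F x t ∂μ := by
        rw [lintegral_lintegral_swap hF.aemeasurable]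
    _ ≤ ENNReal.ofReal p * ∫⁻ t in Set.Ioi (0 : ℝ), 4 * ∫⁻ x, G x t ∂μ :=
        mul_le_mul_right hFG _
    _ = ENNReal.ofReal p * (4 * ∫⁻ x, ∫⁻ t in Set.Ioi (0 : ℝ), G x t ∂volume ∂μ) := by
        rw [lintegral_const_mul _ hG2, lintegral_lintegral_swap hG.aemeasurable]
    _ = _ := by
        simp_rw [hG1]
        rw [lintegral_const_mul _ (by fun_prop)]
        ring

/-! ### Averages, change of measure and Hölder's inequality. -/

theorem ENNReal.finsetProd_ne_zero {ι : Type*} {s : Finset ι} {f : ι → ℝ≥0∞}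
    (h : ∀ i ∈ s, f i ≠ 0) : ∏ i ∈ s, f i ≠ 0 :=
  Finset.prod_ne_zero_iff.2 h

theorem ENNReal.ne_top_of_finsetProd_ne_top {ι : Type*} {s : Finset ι} {f : ι → ℝ≥0∞}
    (h0 : ∀ i ∈ s, f i ≠ 0) (h : ∏ i ∈ s, f i ≠ ∞) {i : ι} (hi : i ∈ s) : f i ≠ ∞ := by
  classical
  intro hf
  rw [← Finset.mul_prod_erase s f hi, hf] at h
  exact h (ENNReal.top_mul
    (ENNReal.finsetProd_ne_zero fun j hj => h0 j (Finset.mem_of_mem_erase hj)))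

theorem laverage_mul_laverage_withDensity {α : Type*} [MeasurableSpace α] (μ : Measure α)
    {u h : α → ℝ≥0∞} (hu : Measurable u) (hh : Measurable h) {s : Set α} (hs : MeasurableSet s)
    (h0 : ∫⁻ x in s, u x ∂μ ≠ 0) (htop : ∫⁻ x in s, u x ∂μ ≠ ∞) :
    (⨍⁻ x in s, u x ∂μ) * ⨍⁻ x in s, h x ∂(μ.withDensity u) = ⨍⁻ x in s, u x * h x ∂μ := by
  rw [setLAverage_eq, setLAverage_eq, setLAverage_eq, withDensity_apply _ hs,
    setLIntegral_withDensity_eq_setLIntegral_mul μ hu hh hs]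
  simp only [Pi.mul_apply]
  rw [ENNReal.div_eq_inv_mul, ENNReal.div_eq_inv_mul, ENNReal.div_eq_inv_mul, mul_assoc,
    ← mul_assoc (∫⁻ x in s, u x ∂μ), ENNReal.mul_inv_cancel h0 htop, one_mul]

theorem setLAverage_Ioo_ne_zero {u : ℝ → ℝ≥0∞} (hu : Measurable u) (h0 : ∀ x, u x ≠ 0) {a b : ℝ}
    (hab : a < b) : ⨍⁻ x in Set.Ioo a b, u x ∂volume ≠ 0 := by
  rw [setLAverage_eq]
  refine ENNReal.div_ne_zero.2 ⟨?_, by simp⟩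
  rw [← pos_iff_ne_zero, lintegral_pos_iff_support hu]
  have : Function.support u = Set.univ := by ext x; simp [h0]
  simp [this, hab]

theorem setLIntegral_Ioo_ne_top_of_laverage {u : ℝ → ℝ≥0∞} {a b : ℝ}
    (h : ⨍⁻ x in Set.Ioo a b, u x ∂volume ≠ ∞) : ∫⁻ x in Set.Ioo a b, u x ≠ ∞ := by
  rw [setLAverage_eq] at h
  intro h'
  rw [h', ENNReal.top_div] at h
  simp at h

/-- Hölder's inequality for the constant function one, written as a product of powers. -/
theorem one_le_lintegral_rpow_mul_prod {α ι : Type*} [Fintype ι] [MeasurableSpace α]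
    (P : Measure α) [IsProbabilityMeasure P] {σ : ι → α → ℝ≥0∞} (hσ : ∀ j, Measurable (σ j))
    (hσ0 : ∀ j x, σ j x ≠ 0) (hσt : ∀ j x, σ j x ≠ ∞) {θ : ℝ} (hθ : 0 < θ) {b : ι → ℝ}
    (hb : ∀ j, 0 ≤ b j) :
    1 ≤ (∫⁻ x, ∏ j, σ j x ^ (-(b j / θ)) ∂P) ^ θ * ∏ j, (∫⁻ x, σ j x ∂P) ^ b j := by
  have ht : 0 < θ + ∑ j, b j := add_pos_of_pos_of_nonneg hθ (Finset.sum_nonneg fun j _ => hb j)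
  set t := θ + ∑ j, b j with ht_def
  -- Dividing the exponents by their sum `t` puts them in Hölder form; the power `t` is restored at
  -- the end.
  have h1 := ENNReal.lintegral_mul_prod_norm_pow_le (μ := P) Finset.univ
    (g := fun x => ∏ j, σ j x ^ (-(b j / θ))) (f := σ)
    (Measurable.aemeasurable (by fun_prop)) (fun j _ => (hσ j).aemeasurable) (θ / t)
    (p := fun j => b j / t) (by rw [← Finset.sum_div, ← add_div, ← ht_def, div_self ht.ne'])
    (by positivity) (fun j _ => div_nonneg (hb j) ht.le)
  have h2 : ∀ x, (∏ j, σ j x ^ (-(b j / θ))) ^ (θ / t) * ∏ j, σ j x ^ (b j / t) = 1 := fun x => by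
    rw [← ENNReal.prod_rpow_of_nonneg (by positivity), ← Finset.prod_mul_distrib]
    refine Finset.prod_eq_one fun j _ => ?_
    rw [← ENNReal.rpow_mul, ← ENNReal.rpow_add _ _ (hσ0 j x) (hσt j x)]
    have : -(b j / θ) * (θ / t) + b j / t = 0 := by field_simp; ring
    rw [this, ENNReal.rpow_zero]
  simp_rw [h2] at h1
  rw [lintegral_const, measure_univ, mul_one] at h1
  have h3 := ENNReal.rpow_le_rpow h1 ht.le
  rw [ENNReal.one_rpow, ENNReal.mul_rpow_of_nonneg _ _ ht.le, ← ENNReal.rpow_mul,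
    div_mul_cancel₀ _ ht.ne', ← ENNReal.prod_rpow_of_nonneg ht.le] at h3
  simpa only [← ENNReal.rpow_mul, div_mul_cancel₀ _ ht.ne'] using h3

/-! ### Dual weights and their maximal functions. -/

/-- The dual weight `w^{-r/(S-r)}`; with `S = 1/s` and `r = 1/q` this is `w^{-s/(q-s)}`. -/
noncomputable def dualWeight (S r : ℝ) (W : ℝ → ℝ≥0∞) (x : ℝ) : ℝ≥0∞ :=
  W x ^ (-(r / (S - r)))

section dualWeight

variable {S r : ℝ} {W : ℝ → ℝ≥0∞}

theorem measurable_dualWeight (hW : Measurable W) : Measurable (dualWeight S r W) :=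
  hW.pow_const _

theorem dualWeight_ne_zero (h0 : ∀ x, W x ≠ 0) (ht : ∀ x, W x ≠ ∞) (x : ℝ) :
    dualWeight S r W x ≠ 0 :=
  (ENNReal.rpow_pos (pos_iff_ne_zero.2 (h0 x)) (ht x)).ne'

theorem dualWeight_ne_top (h0 : ∀ x, W x ≠ 0) (ht : ∀ x, W x ≠ ∞) (x : ℝ) :
    dualWeight S r W x ≠ ∞ :=
  ENNReal.rpow_ne_top_of_ne_zero (h0 x) (ht x)

theorem dualWeight_zero_right (x : ℝ) : dualWeight S 0 W x = 1 := by
  simp [dualWeight]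

theorem dualWeight_mul_rpow (h0 : ∀ x, W x ≠ 0) (ht : ∀ x, W x ≠ ∞) (hr : 0 < r) (hrS : r < S)
    (x : ℝ) : dualWeight S r W x ^ (S / r - 1) * W x = 1 := by
  have : 0 < S - r := sub_pos.2 hrS
  rw [dualWeight, ← ENNReal.rpow_mul]
  nth_rewrite 2 [← ENNReal.rpow_one (W x)]
  rw [← ENNReal.rpow_add _ _ (h0 x) (ht x)]
  have : -(r / (S - r)) * (S / r - 1) + 1 = 0 := by field_simp; ring
  rw [this, ENNReal.rpow_zero]

/-- Since `σ^{1-S/r} = W`, the `L^{S/r}(σ)` norm of `g/σ` is the `L^{S/r}(W)` norm of `g`; this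
dictates the choice of `σ`. -/
theorem dualWeight_mul_div_rpow (h0 : ∀ x, W x ≠ 0) (ht : ∀ x, W x ≠ ∞) (hr : 0 < r) (hrS : r < S)
    (g : ℝ≥0∞) (x : ℝ) :
    dualWeight S r W x * (g / dualWeight S r W x) ^ (S / r) = g ^ (S / r) * W x := by
  have hp : 0 ≤ S / r := div_nonneg (hr.le.trans hrS.le) hr.le
  have s0 := dualWeight_ne_zero (S := S) (r := r) h0 ht x
  have st := dualWeight_ne_top (S := S) (r := r) h0 ht x
  have h1 := dualWeight_mul_rpow h0 ht hr hrS x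
  set d := dualWeight S r W x
  rw [ENNReal.div_rpow_of_nonneg _ _ hp, ENNReal.div_eq_inv_mul, ← ENNReal.rpow_neg,
    ← mul_assoc, mul_comm _ (W x)]
  congr 1
  have h2 : d * d ^ (-(S / r)) = d ^ (-(S / r - 1)) := by
    nth_rewrite 1 [← ENNReal.rpow_one d]
    rw [← ENNReal.rpow_add _ _ s0 st]
    congr 1
    ring
  rw [h2, ENNReal.rpow_neg]
  exact (ENNReal.eq_inv_of_mul_eq_one_left (by rwa [mul_comm])).symm

theorem exists_lintegral_dualWeight_mul_intervalMaximal_le (hW : Measurable W) (h0 : ∀ x, W x ≠ 0)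
    (ht : ∀ x, W x ≠ ∞) (hr : 0 < r) (hrS : r < S) :
    ∃ C : ℝ≥0∞, C ≠ ∞ ∧ ∀ g : ℝ → ℝ≥0∞, Measurable g →
      ∫⁻ x, dualWeight S r W x * intervalMaximal (volume.withDensity (dualWeight S r W))
        (fun y => g y / dualWeight S r W y) x ^ (S / r) ≤ C * ∫⁻ x, g x ^ (S / r) * W x := by
  obtain ⟨C, hC, h⟩ := exists_lintegral_intervalMaximal_rpow_le ((one_lt_div hr).2 hrS)
  have hd := measurable_dualWeight (S := S) (r := r) hW
  refine ⟨C, hC, fun g hg => ?_⟩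
  have h1 := h (volume.withDensity (dualWeight S r W)) (fun y => g y / dualWeight S r W y)
    (hg.div hd)
  have hm : Measurable fun x => (g x / dualWeight S r W x) ^ (S / r) := (hg.div hd).pow_const _
  rw [lintegral_withDensity_eq_lintegral_mul _ hd
      ((measurable_intervalMaximal _ _).pow_const _),
    lintegral_withDensity_eq_lintegral_mul _ hd hm] at h1
  simpa only [Pi.mul_apply, dualWeight_mul_div_rpow h0 ht hr hrS] using h1

end dualWeight

/-! ### Sufficiency of the weight condition. -/

section sufficiency

variable {n : ℕ} {S r : Fin n → ℝ} {W : Fin n → ℝ → ℝ≥0∞}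

/-- The product weight `∏ⱼ wⱼ^{rⱼ/R}` with `R = ∑ⱼ rⱼ`. -/
noncomputable def prodWeight (r : Fin n → ℝ) (W : Fin n → ℝ → ℝ≥0∞) (x : ℝ) : ℝ≥0∞ :=
  ∏ j, W j x ^ (r j / ∑ i, r i)

theorem measurable_prodWeight (hW : ∀ j, Measurable (W j)) : Measurable (prodWeight r W) :=
  Finset.measurable_fun_prod _ fun j _ => (hW j).pow_const _

theorem prodWeight_ne_zero (h0 : ∀ j x, W j x ≠ 0) (ht : ∀ j x, W j x ≠ ∞) (x : ℝ) :
    prodWeight r W x ≠ 0 :=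
  ENNReal.finsetProd_ne_zero fun j _ => (ENNReal.rpow_pos (pos_iff_ne_zero.2 (h0 j x)) (ht j x)).ne'

theorem prodWeight_ne_top (h0 : ∀ j x, W j x ≠ 0) (ht : ∀ j x, W j x ≠ ∞) (x : ℝ) :
    prodWeight r W x ≠ ∞ :=
  ENNReal.prod_ne_top fun j _ => ENNReal.rpow_ne_top_of_ne_zero (h0 j x) (ht j x)

/-- The characteristic of the vector weight on the interval `(a, b)`. -/
noncomputable def weightCharacteristic (S r : Fin n → ℝ) (W : Fin n → ℝ → ℝ≥0∞) (a b : ℝ) : ℝ≥0∞ :=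
  (⨍⁻ x in Set.Ioo a b, prodWeight r W x ∂volume) ^ (∑ i, r i) *
    ∏ j, (⨍⁻ x in Set.Ioo a b, dualWeight (S j) (r j) (W j) x ∂volume) ^ (S j - r j)

/-- No factor of the characteristic vanishes, so an infinite one cannot be hidden by `0 * ∞ = 0`. -/
theorem laverage_ne_top_of_weightCharacteristic_ne_top (hW : ∀ j, Measurable (W j))
    (h0 : ∀ j x, W j x ≠ 0) (ht : ∀ j x, W j x ≠ ∞) (hrS : ∀ j, r j < S j) (hR : 0 < ∑ i, r i)
    {a b : ℝ} (hab : a < b) (hK : weightCharacteristic S r W a b ≠ ∞) :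
    ⨍⁻ x in Set.Ioo a b, prodWeight r W x ∂volume ≠ ∞ ∧
      ∀ j, ⨍⁻ x in Set.Ioo a b, dualWeight (S j) (r j) (W j) x ∂volume ≠ ∞ := by
  have hV := setLAverage_Ioo_ne_zero (measurable_prodWeight (r := r) hW) (prodWeight_ne_zero h0 ht) hab
  have hA : ∀ j, ⨍⁻ x in Set.Ioo a b, dualWeight (S j) (r j) (W j) x ∂volume ≠ 0 := fun j =>
    setLAverage_Ioo_ne_zero (measurable_dualWeight (hW j)) (dualWeight_ne_zero (h0 j) (ht j)) hab
  have hV' : (⨍⁻ x in Set.Ioo a b, prodWeight r W x ∂volume) ^ (∑ i, r i) ≠ 0 := by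
    simp [ENNReal.rpow_eq_zero_iff, hV, hR.not_gt]
  have hA' : ∀ j, (⨍⁻ x in Set.Ioo a b, dualWeight (S j) (r j) (W j) x ∂volume) ^ (S j - r j) ≠ 0 :=
    fun j => by
      simp [ENNReal.rpow_eq_zero_iff, hA j, (hrS j).le]
  have hP := ENNReal.finsetProd_ne_zero (s := Finset.univ) fun j _ => hA' j
  constructor
  · intro h
    rw [weightCharacteristic, h, ENNReal.top_rpow_of_pos hR, ENNReal.top_mul hP] at hK
    exact hK rfl
  · intro j h
    have h1 : ∏ j, (⨍⁻ x in Set.Ioo a b, dualWeight (S j) (r j) (W j) x ∂volume) ^ (S j - r j) ≠ ∞ := by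
      intro h2
      rw [weightCharacteristic, h2, ENNReal.mul_top hV'] at hK
      exact hK rfl
    have h2 := ENNReal.ne_top_of_finsetProd_ne_top (fun j _ => hA' j) h1 (Finset.mem_univ j)
    rw [h, ENNReal.top_rpow_of_pos (sub_pos.2 (hrS j))] at h2
    exact h2 rfl

/-- The linear maximal function of `g` adapted to the dual weight, with the exponent `S`; for
`r = 0` it is replaced by the essential supremum. -/
noncomputable def dualMaximal (S r : ℝ) (W g : ℝ → ℝ≥0∞) (x : ℝ) : ℝ≥0∞ :=
  if r = 0 then essSup g volume ^ S else
    intervalMaximal (volume.withDensity (dualWeight S r W)) (fun y => g y / dualWeight S r W y) x ^ S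

theorem measurable_dualMaximal (S r : ℝ) (W g : ℝ → ℝ≥0∞) : Measurable (dualMaximal S r W g) := by
  unfold dualMaximal
  split_ifs
  · exact measurable_const
  · exact (measurable_intervalMaximal _ _).pow_const _

theorem laverage_rpow_le_dualMaximal {S r : ℝ} {W g : ℝ → ℝ≥0∞} (hW : Measurable W)
    (h0 : ∀ x, W x ≠ 0) (ht : ∀ x, W x ≠ ∞) (hg : Measurable g) (hS : 0 ≤ S) {a b y : ℝ}
    (hy : y ∈ Set.Ioo a b) (hA : ⨍⁻ x in Set.Ioo a b, dualWeight S r W x ∂volume ≠ ∞) :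
    (⨍⁻ x in Set.Ioo a b, g x ∂volume) ^ S ≤
      (⨍⁻ x in Set.Ioo a b, dualWeight S r W x ∂volume) ^ S * dualMaximal S r W g y := by
  have hab : a < b := hy.1.trans hy.2
  by_cases hr : r = 0
  · subst hr
    have : ⨍⁻ x in Set.Ioo a b, dualWeight S 0 W x ∂volume = 1 := by
      simp only [dualWeight_zero_right]
      rw [setLAverage_eq, setLIntegral_one, ENNReal.div_self (by simp [hab]) (by simp)]
    rw [this, ENNReal.one_rpow, one_mul, dualMaximal, if_pos rfl]
    gcongr
    exact (laverage_le_essSup _).trans (essSup_mono_measure' Measure.restrict_le_self)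
  · rw [dualMaximal, if_neg hr, ← ENNReal.mul_rpow_of_nonneg _ _ hS]
    have hd := measurable_dualWeight (S := S) (r := r) hW
    have h1 := laverage_mul_laverage_withDensity volume hd (hg.div hd)
      (measurableSet_Ioo (a := a) (b := b))
      (fun h => setLAverage_Ioo_ne_zero hd (dualWeight_ne_zero h0 ht) hab (by
        rw [setLAverage_eq, h, ENNReal.zero_div]))
      (setLIntegral_Ioo_ne_top_of_laverage hA)
    simp only [Pi.div_apply, ENNReal.mul_div_cancel (dualWeight_ne_zero h0 ht _)
      (dualWeight_ne_top h0 ht _)] at h1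
    rw [← h1]
    gcongr
    exact laverage_le_intervalMaximal _ _ hy

end sufficiency

section sufficiency

variable {n : ℕ} {S r : Fin n → ℝ} {W : Fin n → ℝ → ℝ≥0∞}

theorem ENNReal.prod_rpow_neg {ι : Type*} {s : Finset ι} {f : ι → ℝ≥0∞} {c : ι → ℝ}
    (h0 : ∀ i ∈ s, f i ≠ 0) (ht : ∀ i ∈ s, f i ≠ ∞) :
    (∏ i ∈ s, f i ^ (-c i)) * ∏ i ∈ s, f i ^ c i = 1 := by
  rw [← Finset.prod_mul_distrib]
  refine Finset.prod_eq_one fun i hi => ?_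
  rw [← ENNReal.rpow_add _ _ (h0 i hi) (ht i hi), neg_add_cancel, ENNReal.rpow_zero]

/-- Bound for the product of averages of the dual weights by a quotient of averages. -/
theorem prod_rpow_le_of_characteristic_le {ι : Type*} [Fintype ι] {A : ι → ℝ≥0∞} {V Z K : ℝ≥0∞}
    (hA0 : ∀ j, A j ≠ 0) (hAt : ∀ j, A j ≠ ∞) (hV0 : V ≠ 0) (hVt : V ≠ ∞) {S a : ι → ℝ} {R γ : ℝ}
    (hγ : 0 < γ) (hK : V ^ R * ∏ j, A j ^ a j ≤ K)
    (hZ : 1 ≤ Z ^ (γ * R) * ∏ j, A j ^ (γ * a j - S j)) :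
    ∏ j, A j ^ S j ≤ K ^ γ * (V ^ (-(γ * R)) * Z ^ (γ * R)) := by
  have h1 := ENNReal.rpow_le_rpow hK hγ.le
  rw [ENNReal.mul_rpow_of_nonneg _ _ hγ.le, ← ENNReal.prod_rpow_of_nonneg hγ.le] at h1
  simp only [← ENNReal.rpow_mul] at h1
  -- The surplus power is paired with `hZ`, leaving the wanted power `S j`.
  have h2 : ∀ j, A j ^ (a j * γ) = A j ^ (γ * a j - S j) * A j ^ S j := fun j => by
    rw [← ENNReal.rpow_add _ _ (hA0 j) (hAt j)]
    congr 1
    ring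
  simp_rw [h2, Finset.prod_mul_distrib] at h1
  have h3 : V ^ (-(γ * R)) * V ^ (R * γ) = 1 := by
    rw [← ENNReal.rpow_add _ _ hV0 hVt, mul_comm R, neg_add_cancel, ENNReal.rpow_zero]
  set B := ∏ j, A j ^ (γ * a j - S j)
  set D := ∏ j, A j ^ S j
  calc D = V ^ (-(γ * R)) * V ^ (R * γ) * 1 * D := by rw [h3, one_mul, one_mul]
    _ ≤ V ^ (-(γ * R)) * V ^ (R * γ) * (Z ^ (γ * R) * B) * D := by gcongr
    _ = (V ^ (R * γ) * (B * D)) * (V ^ (-(γ * R)) * Z ^ (γ * R)) := by ring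
    _ ≤ _ := by gcongr

/-- The auxiliary function whose maximal function with respect to the product weight dominates the
multilinear maximal function. -/
noncomputable def auxFunction (S r : Fin n → ℝ) (W : Fin n → ℝ → ℝ≥0∞) (γ : ℝ)
    (H : Fin n → ℝ → ℝ≥0∞) (x : ℝ) : ℝ≥0∞ :=
  (prodWeight r W x)⁻¹ *
    ((∏ j, dualWeight (S j) (r j) (W j) x ^ (-((γ * (S j - r j) - S j) / (γ * ∑ i, r i)))) *
      ∏ j, H j x ^ (1 / (γ * ∑ i, r i)))

theorem measurable_auxFunction (hW : ∀ j, Measurable (W j)) {γ : ℝ} {H : Fin n → ℝ → ℝ≥0∞}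
    (hH : ∀ j, Measurable (H j)) : Measurable (auxFunction S r W γ H) :=
  (measurable_prodWeight hW).inv.mul
    ((Finset.measurable_fun_prod _ fun j _ => (measurable_dualWeight (hW j)).pow_const _).mul
      (Finset.measurable_fun_prod _ fun j _ => (hH j).pow_const _))

/-- The powers of each `W j` combine so that `γ` cancels: its choice does not affect the final norm.
-/
theorem auxFunction_rpow_mul_prodWeight (h0 : ∀ j x, W j x ≠ 0) (ht : ∀ j x, W j x ≠ ∞)
    (hrS : ∀ j, r j < S j) (hR : 0 < ∑ i, r i) {γ : ℝ} (hγ : 0 < γ) (H : Fin n → ℝ → ℝ≥0∞) (x : ℝ) :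
    prodWeight r W x * auxFunction S r W γ H x ^ γ =
      ∏ j, (dualWeight (S j) (r j) (W j) x ^ r j * H j x) ^ (1 / ∑ i, r i) := by
  rw [auxFunction, ENNReal.mul_rpow_of_nonneg _ _ hγ.le, ENNReal.mul_rpow_of_nonneg _ _ hγ.le,
    ← ENNReal.prod_rpow_of_nonneg hγ.le, ← ENNReal.prod_rpow_of_nonneg hγ.le, prodWeight,
    ← ENNReal.rpow_neg_one, ← ENNReal.rpow_mul,
    ← ENNReal.prod_rpow_of_ne_top fun j _ => ENNReal.rpow_ne_top_of_ne_zero (h0 j x) (ht j x)]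
  simp only [← Finset.prod_mul_distrib]
  refine Finset.prod_congr rfl fun j _ => ?_
  have ha : 0 < S j - r j := sub_pos.2 (hrS j)
  rw [ENNReal.mul_rpow_of_nonneg _ _ (by positivity), ← mul_assoc, ← mul_assoc]
  simp only [dualWeight, ← ENNReal.rpow_mul]
  rw [← ENNReal.rpow_add _ _ (h0 j x) (ht j x), ← ENNReal.rpow_add _ _ (h0 j x) (ht j x)]
  congr 2
  · field_simp
    ring
  · field_simp

/-- The core domination: `x` is fixed, but the dual maximal functions may be evaluated at any point
of the interval, hence averaged over it inside the auxiliary function. -/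
theorem prod_laverage_rpow_le_intervalMaximal (hW : ∀ j, Measurable (W j))
    (h0 : ∀ j x, W j x ≠ 0) (ht : ∀ j x, W j x ≠ ∞) (hr : ∀ j, 0 ≤ r j) (hrS : ∀ j, r j < S j)
    (hR : 0 < ∑ i, r i) {γ : ℝ} (hγ : 0 < γ) (hγS : ∀ j, S j ≤ γ * (S j - r j)) {K : ℝ≥0∞}
    (hKt : K ≠ ∞) {g : Fin n → ℝ → ℝ≥0∞} (hg : ∀ j, Measurable (g j)) {a b x : ℝ}
    (hx : x ∈ Set.Ioo a b) (hK : weightCharacteristic S r W a b ≤ K) :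
    ∏ j, (⨍⁻ y in Set.Ioo a b, g j y ∂volume) ^ S j ≤
      K ^ γ * intervalMaximal (volume.withDensity (prodWeight r W))
        (auxFunction S r W γ fun j => dualMaximal (S j) (r j) (W j) (g j)) x
          ^ (γ * ∑ i, r i) := by
  have hab : a < b := hx.1.trans hx.2
  obtain ⟨hVt, hAt⟩ := laverage_ne_top_of_weightCharacteristic_ne_top hW h0 ht hrS hR hab
    (ne_top_of_le_ne_top hKt hK)
  have hV0 := setLAverage_Ioo_ne_zero (measurable_prodWeight (r := r) hW)
    (prodWeight_ne_zero h0 ht) hab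
  have hA0 := fun j => setLAverage_Ioo_ne_zero
    (measurable_dualWeight (S := S j) (r := r j) (hW j)) (dualWeight_ne_zero (h0 j) (ht j)) hab
  set R := ∑ i, r i with hRdef
  set H := fun j => dualMaximal (S j) (r j) (W j) (g j) with hH
  have hHm : ∀ j, Measurable (H j) := fun j => measurable_dualMaximal _ _ _ _
  set ν := prodWeight r W with hν
  have hνm : Measurable ν := measurable_prodWeight hW
  set Z : ℝ → ℝ≥0∞ := fun x =>
    ∏ j, dualWeight (S j) (r j) (W j) x ^ (-((γ * (S j - r j) - S j) / (γ * R))) with hZdef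
  have hZm : Measurable Z :=
    Finset.measurable_fun_prod _ fun j _ => (measurable_dualWeight (hW j)).pow_const _
  set V := ⨍⁻ x in Set.Ioo a b, ν x ∂volume with hV
  set A : Fin n → ℝ≥0∞ := fun j => ⨍⁻ x in Set.Ioo a b, dualWeight (S j) (r j) (W j) x ∂volume
    with hA
  have hθ : 0 < γ * R := mul_pos hγ hR
  have : IsProbabilityMeasure ((volume (Set.Ioo a b))⁻¹ • volume.restrict (Set.Ioo a b)) := by
    constructor
    simp only [Measure.smul_apply, Measure.restrict_apply_univ, smul_eq_mul]
    exact ENNReal.inv_mul_cancel (by simp [hab]) (by simp)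
  have hZ1 := one_le_lintegral_rpow_mul_prod
    ((volume (Set.Ioo a b))⁻¹ • volume.restrict (Set.Ioo a b))
    (fun j => measurable_dualWeight (S := S j) (r := r j) (hW j))
    (fun j => dualWeight_ne_zero (h0 j) (ht j)) (fun j => dualWeight_ne_top (h0 j) (ht j)) hθ
    (b := fun j => γ * (S j - r j) - S j) (fun j => sub_nonneg.2 (hγS j))
  simp only [← setLAverage_eq'] at hZ1
  have hD := prod_rpow_le_of_characteristic_le hA0 hAt hV0 hVt hγ hK hZ1
  change ∏ j, A j ^ S j ≤ K ^ γ * (V ^ (-(γ * R)) * (⨍⁻ x in Set.Ioo a b, Z x ∂volume) ^ (γ * R))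
    at hD
  set D := ∏ j, A j ^ S j with hDdef
  have hD0 : D ≠ 0 := ENNReal.finsetProd_ne_zero fun j _ =>
    (ENNReal.rpow_pos (pos_iff_ne_zero.2 (hA0 j)) (hAt j)).ne'
  have hDt : D ≠ ∞ := ENNReal.prod_ne_top fun j _ => ENNReal.rpow_ne_top_of_ne_zero (hA0 j) (hAt j)
  set G := ∏ j, (⨍⁻ y in Set.Ioo a b, g j y ∂volume) ^ S j with hG
  -- Being uniform in `y`, this bound lets the constant `G / D` be moved inside the average of `Z`.
  have hGD : ∀ y ∈ Set.Ioo a b, G / D ≤ ∏ j, H j y := fun y hy => by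
    rw [ENNReal.div_le_iff' hD0 hDt, hG, hDdef, ← Finset.prod_mul_distrib]
    exact Finset.prod_le_prod' fun j _ => laverage_rpow_le_dualMaximal (hW j) (h0 j) (ht j) (hg j)
      ((hr j).trans (hrS j).le) hy (hAt j)
  set e := 1 / (γ * R) with he
  have hee : e * (γ * R) = 1 := by rw [he]; field_simp
  have he0 : 0 ≤ e := by positivity
  have hY : V⁻¹ * ((⨍⁻ x in Set.Ioo a b, Z x ∂volume) * (G / D) ^ e) ≤
      intervalMaximal (volume.withDensity ν) (auxFunction S r W γ H) x := by
    refine le_trans ?_ (laverage_le_intervalMaximal _ _ hx)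
    have h1 := laverage_mul_laverage_withDensity volume hνm
      (measurable_auxFunction (S := S) (r := r) (γ := γ) hW hHm)
      (measurableSet_Ioo (a := a) (b := b))
      (fun h => hV0 (by rw [hV, setLAverage_eq, h, ENNReal.zero_div]))
      (setLIntegral_Ioo_ne_top_of_laverage hVt)
    rw [← hV] at h1
    have h2 : ⨍⁻ y in Set.Ioo a b, auxFunction S r W γ H y ∂(volume.withDensity ν) =
        V⁻¹ * ⨍⁻ y in Set.Ioo a b, ν y * auxFunction S r W γ H y ∂volume := by
      rw [← h1, ← mul_assoc, ENNReal.inv_mul_cancel hV0 hVt, one_mul]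
    rw [h2]
    refine mul_le_mul_right ?_ _
    rw [setLAverage_eq', setLAverage_eq', ← lintegral_mul_const _ hZm, ← setLAverage_eq',
      ← setLAverage_eq', setLAverage_eq, setLAverage_eq]
    refine ENNReal.div_le_div_right (setLIntegral_mono' measurableSet_Ioo fun y hy => ?_) _
    rw [auxFunction, ← mul_assoc, ENNReal.mul_inv_cancel (prodWeight_ne_zero h0 ht y)
      (prodWeight_ne_top h0 ht y), one_mul, ENNReal.prod_rpow_of_nonneg he0]
    exact mul_le_mul_right (ENNReal.rpow_le_rpow (hGD y hy) he0) _
  calc G = D * (G / D) := (ENNReal.mul_div_cancel hD0 hDt).symm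
    _ ≤ K ^ γ * (V ^ (-(γ * R)) * (⨍⁻ x in Set.Ioo a b, Z x ∂volume) ^ (γ * R)) * (G / D) := by
        gcongr
    _ = K ^ γ * (V⁻¹ * ((⨍⁻ x in Set.Ioo a b, Z x ∂volume) * (G / D) ^ e)) ^ (γ * R) := by
        rw [ENNReal.mul_rpow_of_nonneg _ _ hθ.le, ENNReal.mul_rpow_of_nonneg _ _ hθ.le,
          ← ENNReal.rpow_mul, hee, ENNReal.rpow_one, ENNReal.inv_rpow, ENNReal.rpow_neg]
        ring
    _ ≤ _ := by gcongr

/-- The norm of `|f|` expressed through `g = |f|^{1/S}`. -/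
noncomputable def powerNorm (S r : ℝ) (W g : ℝ → ℝ≥0∞) : ℝ≥0∞ :=
  if r = 0 then essSup g volume ^ S else (∫⁻ x, g x ^ (S / r) * W x) ^ r

/-- Hölder with exponents `r j / R` separates the factors, and each is bounded by the maximal
theorem for its dual weight. -/
theorem exists_lintegral_prod_dualMaximal_le (hW : ∀ j, Measurable (W j))
    (h0 : ∀ j x, W j x ≠ 0) (ht : ∀ j x, W j x ≠ ∞) (hr : ∀ j, 0 ≤ r j) (hrS : ∀ j, r j < S j)
    (hR : 0 < ∑ i, r i) :
    ∃ C : ℝ≥0∞, C ≠ ∞ ∧ ∀ g : Fin n → ℝ → ℝ≥0∞, (∀ j, Measurable (g j)) →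
      ∫⁻ x, ∏ j, (dualWeight (S j) (r j) (W j) x ^ r j * dualMaximal (S j) (r j) (W j) (g j) x) ^
        (1 / ∑ i, r i) ≤ C * ∏ j, powerNorm (S j) (r j) (W j) (g j) ^ (1 / ∑ i, r i) := by
  set R := ∑ i, r i with hRdef
  have h1 : ∀ j, ∃ C : ℝ≥0∞, C ≠ ∞ ∧ ∀ g : ℝ → ℝ≥0∞, Measurable g → 0 < r j →
      ∫⁻ x, dualWeight (S j) (r j) (W j) x *
        intervalMaximal (volume.withDensity (dualWeight (S j) (r j) (W j)))
        (fun y => g y / dualWeight (S j) (r j) (W j) y) x ^ (S j / r j) ≤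
          C * ∫⁻ x, g x ^ (S j / r j) * W j x := fun j => by
    rcases (hr j).eq_or_lt with h | h
    · exact ⟨0, by simp, fun g _ h' => absurd h' (by simp [← h])⟩
    · obtain ⟨C, hC, hC'⟩ :=
        exists_lintegral_dualWeight_mul_intervalMaximal_le (hW j) (h0 j) (ht j) h (hrS j)
      exact ⟨C, hC, fun g hg _ => hC' g hg⟩
  choose C hC hCle using h1
  refine ⟨∏ j, C j ^ (r j / R), ENNReal.prod_ne_top fun j _ =>
    ENNReal.rpow_ne_top_of_nonneg (div_nonneg (hr j) hR.le) (hC j), fun g hg => ?_⟩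
  -- Indices with `r j = 0` contribute constants, pulled out before Hölder; their `F j` is a dummy
  -- with exponent zero.
  let c : Fin n → ℝ≥0∞ := fun j => if r j = 0 then (essSup (g j) volume ^ S j) ^ (1 / R) else 1
  let F : Fin n → ℝ → ℝ≥0∞ := fun j x => if r j = 0 then 1 else dualWeight (S j) (r j) (W j) x *
        intervalMaximal (volume.withDensity (dualWeight (S j) (r j) (W j)))
        (fun y => g j y / dualWeight (S j) (r j) (W j) y) x ^ (S j / r j)
  have hF : ∀ j, Measurable (F j) := fun j => by
    by_cases h : r j = 0
    · simp only [F, h, if_true]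
      exact measurable_const
    · simp only [F, h, if_false]
      exact (measurable_dualWeight (hW j)).mul ((measurable_intervalMaximal _ _).pow_const _)
  have hterm : ∀ j x, (dualWeight (S j) (r j) (W j) x ^ r j *
      dualMaximal (S j) (r j) (W j) (g j) x) ^ (1 / R) = c j * F j x ^ (r j / R) := fun j x => by
    by_cases h : r j = 0
    · simp [c, F, h, dualMaximal]
    · have hj : 0 < r j := (hr j).lt_of_ne' h
      simp only [c, F, h, dualMaximal, if_false, one_mul]
      rw [ENNReal.mul_rpow_of_nonneg _ _ (by positivity),
        ENNReal.mul_rpow_of_nonneg _ _ (by positivity), ← ENNReal.rpow_mul, ← ENNReal.rpow_mul,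
        ← ENNReal.rpow_mul]
      congr 2
      · ring
      · field_simp
  simp_rw [hterm, Finset.prod_mul_distrib]
  rw [lintegral_const_mul _ (Finset.measurable_fun_prod _ fun j _ => (hF j).pow_const _)]
  have h2 := ENNReal.lintegral_prod_norm_pow_le (μ := volume) Finset.univ
    (fun j _ => (hF j).aemeasurable) (p := fun j => r j / R)
    (by rw [← Finset.sum_div, ← hRdef, div_self hR.ne']) (fun j _ => div_nonneg (hr j) hR.le)
  refine (mul_le_mul_right h2 _).trans ?_
  rw [← Finset.prod_mul_distrib, ← Finset.prod_mul_distrib]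
  refine Finset.prod_le_prod' fun j _ => ?_
  by_cases h : r j = 0
  · simp [c, h, powerNorm]
  · have hj : 0 < r j := (hr j).lt_of_ne' h
    have h3 := hCle j (g j) (hg j) hj
    have h4 : 0 ≤ r j / R := div_nonneg (hr j) hR.le
    simp only [c, F, h, powerNorm, if_false, one_mul]
    refine (ENNReal.rpow_le_rpow h3 h4).trans_eq ?_
    rw [ENNReal.mul_rpow_of_nonneg _ _ h4, ← ENNReal.rpow_mul, mul_one_div]

theorem exists_multilinear_maximal_le (hW : ∀ j, Measurable (W j))
    (h0 : ∀ j x, W j x ≠ 0) (ht : ∀ j x, W j x ≠ ∞) (hr : ∀ j, 0 ≤ r j) (hrS : ∀ j, r j < S j)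
    (hR : 0 < ∑ i, r i) {K : ℝ≥0∞} (hKt : K ≠ ∞)
    (hK : ∀ a b, a < b → weightCharacteristic S r W a b ≤ K) :
    ∃ C : ℝ≥0∞, C ≠ ∞ ∧ ∀ g : Fin n → ℝ → ℝ≥0∞, (∀ j, Measurable (g j)) →
      (∫⁻ x, prodWeight r W x * (⨆ (a : ℝ) (b : ℝ) (_ : x ∈ Set.Ioo a b),
        ∏ j, (⨍⁻ y in Set.Ioo a b, g j y ∂volume) ^ S j) ^ (1 / ∑ i, r i)) ^ (∑ i, r i) ≤
      C * ∏ j, powerNorm (S j) (r j) (W j) (g j) := by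
  have hS : ∀ j, 0 < S j / (S j - r j) := fun j =>
    div_pos ((hr j).trans_lt (hrS j)) (sub_pos.2 (hrS j))
  obtain ⟨j₀, -, hj₀⟩ : ∃ j ∈ Finset.univ, 0 < r j := by
    by_contra! h
    exact absurd (Finset.sum_nonpos h) hR.not_ge
  -- Large enough for every `hγS`, and above one as the maximal theorem requires.
  set γ := 1 + ∑ j, S j / (S j - r j) with hγdef
  have hγ1 : 1 < γ := by
    have := Finset.sum_pos (fun j _ => hS j) ⟨j₀, Finset.mem_univ _⟩
    linarith
  have hγ : 0 < γ := by linarith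
  have hγS : ∀ j, S j ≤ γ * (S j - r j) := fun j => by
    rw [← div_le_iff₀ (sub_pos.2 (hrS j))]
    have := Finset.single_le_sum (f := fun j => S j / (S j - r j)) (fun j _ => (hS j).le)
      (Finset.mem_univ j)
    linarith
  obtain ⟨C₁, hC₁, hM⟩ := exists_lintegral_intervalMaximal_rpow_le hγ1
  obtain ⟨C₂, hC₂, hP⟩ := exists_lintegral_prod_dualMaximal_le hW h0 ht hr hrS hR
  set R := ∑ i, r i with hRdef
  have hR' : 0 ≤ 1 / R := by positivity
  refine ⟨((K ^ γ) ^ (1 / R) * (C₁ * C₂)) ^ R, ?_, fun g hg => ?_⟩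
  · exact ENNReal.rpow_ne_top_of_nonneg hR.le (ENNReal.mul_ne_top
      (ENNReal.rpow_ne_top_of_nonneg hR' (ENNReal.rpow_ne_top_of_nonneg hγ.le hKt))
      (ENNReal.mul_ne_top hC₁ hC₂))
  set H := fun j => dualMaximal (S j) (r j) (W j) (g j) with hH
  have hHm : ∀ j, Measurable (H j) := fun j => measurable_dualMaximal _ _ _ _
  have hνm : Measurable (prodWeight r W) := measurable_prodWeight hW
  have hYm : Measurable (auxFunction S r W γ H) := measurable_auxFunction hW hHm
  have hpt : ∀ x, (⨆ (a : ℝ) (b : ℝ) (_ : x ∈ Set.Ioo a b),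
        ∏ j, (⨍⁻ y in Set.Ioo a b, g j y ∂volume) ^ S j) ^ (1 / R) ≤ (K ^ γ) ^ (1 / R) *
        intervalMaximal (volume.withDensity (prodWeight r W)) (auxFunction S r W γ H) x ^ γ := by
    intro x
    have h1 : (⨆ (a : ℝ) (b : ℝ) (_ : x ∈ Set.Ioo a b),
        ∏ j, (⨍⁻ y in Set.Ioo a b, g j y ∂volume) ^ S j) ≤ K ^ γ *
        intervalMaximal (volume.withDensity (prodWeight r W)) (auxFunction S r W γ H) x ^ (γ * R) :=
      iSup_le fun a => iSup_le fun b => iSup_le fun hx =>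
        prod_laverage_rpow_le_intervalMaximal hW h0 ht hr hrS hR hγ hγS hKt hg hx
          (hK a b (hx.1.trans hx.2))
    refine (ENNReal.rpow_le_rpow h1 hR').trans_eq ?_
    rw [ENNReal.mul_rpow_of_nonneg _ _ hR', ← ENNReal.rpow_mul (intervalMaximal _ _ x),
      mul_assoc γ, mul_one_div_cancel hR.ne', mul_one]
  have hMm := (measurable_intervalMaximal (volume.withDensity (prodWeight r W))
    (auxFunction S r W γ H)).pow_const γ
  have hM1 := hM (volume.withDensity (prodWeight r W)) (auxFunction S r W γ H) hYm
  rw [lintegral_withDensity_eq_lintegral_mul _ hνm hMm,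
    lintegral_withDensity_eq_lintegral_mul _ hνm (hYm.pow_const γ)] at hM1
  simp only [Pi.mul_apply, auxFunction_rpow_mul_prodWeight h0 ht hrS hR hγ] at hM1
  have hfin : ∫⁻ x, prodWeight r W x * (⨆ (a : ℝ) (b : ℝ) (_ : x ∈ Set.Ioo a b),
        ∏ j, (⨍⁻ y in Set.Ioo a b, g j y ∂volume) ^ S j) ^ (1 / R) ≤
      (K ^ γ) ^ (1 / R) * (C₁ * C₂) * (∏ j, powerNorm (S j) (r j) (W j) (g j)) ^ (1 / R) := by
    calc _ ≤ ∫⁻ x, (K ^ γ) ^ (1 / R) * (prodWeight r W x *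
          intervalMaximal (volume.withDensity (prodWeight r W)) (auxFunction S r W γ H) x ^ γ) := by
          refine lintegral_mono fun x => ?_
          rw [mul_left_comm]
          exact mul_le_mul_right (hpt x) _
      _ = (K ^ γ) ^ (1 / R) * ∫⁻ x, (prodWeight r W x *
          intervalMaximal (volume.withDensity (prodWeight r W)) (auxFunction S r W γ H) x ^ γ) :=
          lintegral_const_mul _ (hνm.mul hMm)
      _ ≤ (K ^ γ) ^ (1 / R) * (C₁ * (C₂ * ∏ j, powerNorm (S j) (r j) (W j) (g j) ^ (1 / R))) :=
          mul_le_mul_right (hM1.trans (mul_le_mul_right (hP g hg) _)) _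
      _ = _ := by
          rw [ENNReal.prod_rpow_of_nonneg hR']
          ring
  refine (ENNReal.rpow_le_rpow hfin hR.le).trans_eq ?_
  rw [ENNReal.mul_rpow_of_nonneg _ _ hR.le, ← ENNReal.rpow_mul (∏ j, _),
    one_div_mul_cancel hR.ne', ENNReal.rpow_one]

end sufficiency

/-! ### Necessity of the weight condition. -/

section necessity

variable {n : ℕ} {S r : Fin n → ℝ} {W : Fin n → ℝ → ℝ≥0∞}

theorem ENNReal.rpow_finsetSum {ι : Type*} {x : ℝ≥0∞} (h0 : x ≠ 0) (ht : x ≠ ∞) (s : Finset ι)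
    (c : ι → ℝ) : x ^ (∑ i ∈ s, c i) = ∏ i ∈ s, x ^ c i := by
  classical
  induction s using Finset.induction_on with
  | empty => simp
  | insert i s hi ih =>
    rw [Finset.sum_insert hi, Finset.prod_insert hi, ENNReal.rpow_add _ _ h0 ht, ih]

/-- Nonzero limits exclude `0 * ∞`, where multiplication is discontinuous; infinite limits remain
allowed. -/
theorem ENNReal.tendsto_finsetProd_of_ne_zero {ι α : Type*} {l : Filter α} (s : Finset ι)
    {f : ι → α → ℝ≥0∞} {a : ι → ℝ≥0∞} (h : ∀ i ∈ s, Filter.Tendsto (f i) l (nhds (a i)))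
    (h0 : ∀ i ∈ s, a i ≠ 0) :
    Filter.Tendsto (fun x => ∏ i ∈ s, f i x) l (nhds (∏ i ∈ s, a i)) := by
  classical
  induction s using Finset.induction_on with
  | empty => simpa using tendsto_const_nhds
  | insert i s hi ih =>
    simp only [Finset.prod_insert hi]
    refine ENNReal.Tendsto.mul (h i (by simp)) (Or.inl (h0 i (by simp)))
      (ih (fun j hj => h j (by simp [hj])) fun j hj => h0 j (by simp [hj]))
      (Or.inl (ENNReal.finsetProd_ne_zero fun j hj => h0 j (by simp [hj])))

theorem tendsto_laverage_min_nat {u : ℝ → ℝ≥0∞} (hu : Measurable u) (a b : ℝ) :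
    Filter.Tendsto (fun N : ℕ => ⨍⁻ x in Set.Ioo a b, min (u x) N ∂volume) Filter.atTop
      (nhds (⨍⁻ x in Set.Ioo a b, u x ∂volume)) := by
  simp only [setLAverage_eq']
  refine lintegral_tendsto_of_tendsto_of_monotone (fun N => by fun_prop)
    (Filter.Eventually.of_forall fun x N M h => ?_) (Filter.Eventually.of_forall fun x => ?_)
  · exact min_le_min le_rfl (by exact_mod_cast h)
  · have h1 := (tendsto_const_nhds (x := u x)).min ENNReal.tendsto_nat_nhds_top
    simpa using h1

theorem min_rpow_mul_le {W : ℝ → ℝ≥0∞} {S r : ℝ} (h0 : ∀ x, W x ≠ 0) (ht : ∀ x, W x ≠ ∞)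
    (hr : 0 < r) (hrS : r < S) (N : ℕ) (x : ℝ) :
    min (dualWeight S r W x) N ^ (S / r) * W x ≤ min (dualWeight S r W x) N := by
  have hp : 0 ≤ S / r - 1 := sub_nonneg.2 ((one_le_div hr).2 hrS.le)
  set d := dualWeight S r W x with hd
  have h1 : min d N ^ (S / r) = min d N * min d N ^ (S / r - 1) := by
    nth_rewrite 2 [← ENNReal.rpow_one (min d N)]
    rw [← ENNReal.rpow_add_of_nonneg _ _ zero_le_one hp, add_sub_cancel]
  calc min d N ^ (S / r) * W x = min d N * (min d N ^ (S / r - 1) * W x) := by rw [h1, mul_assoc]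
    _ ≤ min d N * (d ^ (S / r - 1) * W x) := by gcongr; exact min_le_left _ _
    _ = min d N := by rw [hd, dualWeight_mul_rpow h0 ht hr hrS, mul_one]

theorem powerNorm_indicator_min_le {W : ℝ → ℝ≥0∞} {S r : ℝ} (h0 : ∀ x, W x ≠ 0)
    (ht : ∀ x, W x ≠ ∞) (hr : 0 ≤ r) (hrS : r < S) (N : ℕ) (a b : ℝ) :
    powerNorm S r W ((Set.Ioo a b).indicator fun x => min (dualWeight S r W x) N) ≤
      (∫⁻ x in Set.Ioo a b, min (dualWeight S r W x) N) ^ r := by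
  rcases hr.eq_or_lt with h | h
  · subst h
    rw [powerNorm, if_pos rfl, ENNReal.rpow_zero]
    refine ENNReal.rpow_le_one ?_ hrS.le
    refine essSup_le_of_ae_le _ (Filter.Eventually.of_forall fun x => ?_)
    refine Set.indicator_apply_le' (fun _ => ?_) fun _ => bot_le
    exact (min_le_left _ _).trans (dualWeight_zero_right x).le
  · rw [powerNorm, if_neg h.ne', ← lintegral_indicator measurableSet_Ioo]
    refine ENNReal.rpow_le_rpow (lintegral_mono fun x => ?_) hr
    by_cases hx : x ∈ Set.Ioo a b
    · simp only [Set.indicator_of_mem hx]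
      exact min_rpow_mul_le h0 ht h hrS N x
    · simp [Set.indicator_of_notMem hx, ENNReal.zero_rpow_of_pos (div_pos (h.trans hrS) h)]

/-- Dual weights are not known to be locally integrable, so they are truncated to make the division
legitimate; the bound does not depend on the truncation and passes to the limit. Finite-valued test
functions suffice, so they can come from complex-valued `f`. -/
theorem weightCharacteristic_le_of_maximal_le (hW : ∀ j, Measurable (W j))
    (h0 : ∀ j x, W j x ≠ 0) (ht : ∀ j x, W j x ≠ ∞) (hr : ∀ j, 0 ≤ r j) (hrS : ∀ j, r j < S j)
    (hR : 0 < ∑ i, r i) {C : ℝ≥0∞}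
    (hC : ∀ g : Fin n → ℝ → ℝ≥0∞, (∀ j, Measurable (g j)) → (∀ j x, g j x ≠ ∞) →
      (∫⁻ x, prodWeight r W x * (⨆ (a : ℝ) (b : ℝ) (_ : x ∈ Set.Ioo a b),
        ∏ j, (⨍⁻ y in Set.Ioo a b, g j y ∂volume) ^ S j) ^ (1 / ∑ i, r i)) ^ (∑ i, r i) ≤
      C * ∏ j, powerNorm (S j) (r j) (W j) (g j)) {a b : ℝ} (hab : a < b) :
    weightCharacteristic S r W a b ≤ C := by
  set R := ∑ i, r i with hRdef
  have hνm : Measurable (prodWeight r W) := measurable_prodWeight hW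
  have hdm : ∀ j, Measurable (dualWeight (S j) (r j) (W j)) := fun j => measurable_dualWeight (hW j)
  have hL0 : volume (Set.Ioo a b) ≠ 0 := by simp [hab]
  have hLt : volume (Set.Ioo a b) ≠ ∞ := by simp
  set L := volume (Set.Ioo a b) with hL
  set V := ⨍⁻ x in Set.Ioo a b, prodWeight r W x ∂volume with hV
  set A : ℕ → Fin n → ℝ≥0∞ := fun N j =>
    ⨍⁻ x in Set.Ioo a b, min (dualWeight (S j) (r j) (W j) x) N ∂volume with hA
  -- Level `N + 1` keeps the truncated weights nonzero.
  have hbound : ∀ N : ℕ, V ^ R * ∏ j, A (N + 1) j ^ (S j - r j) ≤ C := by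
    intro N
    have hA0 : ∀ j, A (N + 1) j ≠ 0 := fun j =>
      setLAverage_Ioo_ne_zero ((hdm j).min measurable_const) (fun x => by
        have := dualWeight_ne_zero (S := S j) (r := r j) (h0 j) (ht j) x
        simp only [min_eq_bot.not, ← bot_eq_zero]
        simp [this]) hab
    have hAt : ∀ j, A (N + 1) j ≠ ∞ := fun j => by
      refine ne_top_of_le_ne_top (b := ((N + 1 : ℕ) : ℝ≥0∞)) (by simp) ?_
      refine (laverage_mono_ae (g := fun _ => ((N + 1 : ℕ) : ℝ≥0∞))
        (Filter.Eventually.of_forall fun x => min_le_right _ _)).trans ?_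
      exact (laverage_le_essSup _).trans (essSup_le_of_ae_le _ (by simp [Filter.EventuallyLE]))
    have hAL : ∀ j, ∫⁻ x in Set.Ioo a b, min (dualWeight (S j) (r j) (W j) x) (N + 1 : ℕ) =
        L * A (N + 1) j := fun j => by
      simp only [hA]
      rw [setLAverage_eq, ENNReal.mul_div_cancel hL0 hLt]
    let g : Fin n → ℝ → ℝ≥0∞ := fun j =>
      (Set.Ioo a b).indicator fun x => min (dualWeight (S j) (r j) (W j) x) (N + 1 : ℕ)
    have hgA : ∀ j, ⨍⁻ y in Set.Ioo a b, g j y ∂volume = A (N + 1) j := fun j => by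
      simp only [hA]
      rw [setLAverage_eq, setLAverage_eq]
      congr 1
      exact setLIntegral_congr_fun measurableSet_Ioo fun x hx => Set.indicator_of_mem hx _
    have h1 := hC g (fun j => ((hdm j).min measurable_const).indicator measurableSet_Ioo)
      fun j x => by
        refine ne_top_of_le_ne_top (b := ((N + 1 : ℕ) : ℝ≥0∞)) (by simp) ?_
        exact Set.indicator_apply_le' (fun _ => min_le_right _ _) fun _ => bot_le
    set P := ∏ j, A (N + 1) j ^ S j with hP
    have h2 : L * V * P ^ (1 / R) ≤ ∫⁻ x, prodWeight r W x * (⨆ (a : ℝ) (b : ℝ)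
        (_ : x ∈ Set.Ioo a b), ∏ j, (⨍⁻ y in Set.Ioo a b, g j y ∂volume) ^ S j) ^ (1 / R) := by
      calc L * V * P ^ (1 / R) = ∫⁻ x in Set.Ioo a b, prodWeight r W x * P ^ (1 / R) := by
            rw [lintegral_mul_const _ hνm, hV, setLAverage_eq, ENNReal.mul_div_cancel hL0 hLt]
        _ ≤ ∫⁻ x in Set.Ioo a b, prodWeight r W x * (⨆ (a : ℝ) (b : ℝ)
              (_ : x ∈ Set.Ioo a b), ∏ j, (⨍⁻ y in Set.Ioo a b, g j y ∂volume) ^ S j) ^ (1 / R) := by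
            refine setLIntegral_mono' measurableSet_Ioo fun x hx => ?_
            refine mul_le_mul_right (ENNReal.rpow_le_rpow ?_ (by positivity)) _
            refine le_iSup_of_le a (le_iSup_of_le b (le_iSup_of_le hx ?_))
            simp only [hgA, hP]
            exact le_rfl
        _ ≤ _ := setLIntegral_le_lintegral _ _
    have h3 := (ENNReal.rpow_le_rpow h2 hR.le).trans (h1.trans (mul_le_mul_right
      (Finset.prod_le_prod' fun j _ => powerNorm_indicator_min_le (h0 j) (ht j) (hr j) (hrS j)
        (N + 1) a b) _))
    simp_rw [hAL] at h3
    have h4 : ∏ j, (L * A (N + 1) j) ^ r j = L ^ R * ∏ j, A (N + 1) j ^ r j := by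
      rw [hRdef, ENNReal.rpow_finsetSum hL0 hLt, ← Finset.prod_mul_distrib]
      exact Finset.prod_congr rfl fun j _ => ENNReal.mul_rpow_of_nonneg _ _ (hr j)
    rw [h4, ENNReal.mul_rpow_of_nonneg _ _ hR.le, ENNReal.mul_rpow_of_nonneg _ _ hR.le,
      ← ENNReal.rpow_mul, one_div_mul_cancel hR.ne', ENNReal.rpow_one] at h3
    have hLR : L ^ (-R) * L ^ R = 1 := by
      rw [← ENNReal.rpow_add _ _ hL0 hLt, neg_add_cancel, ENNReal.rpow_zero]
    have hneg := ENNReal.prod_rpow_neg (s := Finset.univ) (f := A (N + 1)) (c := r)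
      (fun j _ => hA0 j) (fun j _ => hAt j)
    have hsplit : ∏ j, A (N + 1) j ^ (S j - r j) = P * ∏ j, A (N + 1) j ^ (-r j) := by
      rw [hP, ← Finset.prod_mul_distrib]
      exact Finset.prod_congr rfl fun j _ => by
        rw [← ENNReal.rpow_add _ _ (hA0 j) (hAt j), sub_eq_add_neg]
    rw [hsplit]
    set B := ∏ j, A (N + 1) j ^ (-r j)
    set D := ∏ j, A (N + 1) j ^ r j
    -- The powers of the length match because `R = ∑ r`; dividing by the norms turns the exponents
    -- `S j` into `S j - r j`.
    calc V ^ R * (P * B) = L ^ (-R) * L ^ R * (V ^ R * (P * B)) := by rw [hLR, one_mul]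
      _ = L ^ (-R) * B * (L ^ R * V ^ R * P) := by ring
      _ ≤ L ^ (-R) * B * (C * (L ^ R * D)) := mul_le_mul_right h3 _
      _ = (L ^ (-R) * L ^ R) * (B * D) * C := by ring
      _ = C := by rw [hLR, hneg, one_mul, one_mul]
  have hAj0 : ∀ j, (⨍⁻ x in Set.Ioo a b, dualWeight (S j) (r j) (W j) x ∂volume) ^ (S j - r j) ≠ 0 :=
    fun j => by
      have := setLAverage_Ioo_ne_zero (hdm j) (dualWeight_ne_zero (h0 j) (ht j)) hab
      simp [ENNReal.rpow_eq_zero_iff, this, (hrS j).le]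
  have hV0 : V ^ R ≠ 0 := by
    have := setLAverage_Ioo_ne_zero hνm (prodWeight_ne_zero h0 ht) hab
    rw [← hV] at this
    simp [ENNReal.rpow_eq_zero_iff, this, hR.not_gt]
  have hlim : Filter.Tendsto (fun N : ℕ => V ^ R * ∏ j, A (N + 1) j ^ (S j - r j)) Filter.atTop
      (nhds (weightCharacteristic S r W a b)) := by
    refine ENNReal.Tendsto.const_mul (ENNReal.tendsto_finsetProd_of_ne_zero _ (fun j _ => ?_)
      fun j _ => hAj0 j) (Or.inl (ENNReal.finsetProd_ne_zero fun j _ => hAj0 j))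
    exact (ENNReal.continuous_rpow_const.tendsto _).comp
      ((tendsto_laverage_min_nat (hdm j) a b).comp (Filter.tendsto_add_atTop_nat 1))
  exact le_of_tendsto' hlim hbound

end necessity

/-! ### Passage between the original exponents and weights and their reciprocal, extended-valued
form. -/

section translation

/-- Changing a weight on a null set affects no integral, and makes all power identities valid at
every point. -/
theorem exists_measurable_weight {w : ℝ → ℝ} (hw : IsWeight w) :
    ∃ W : ℝ → ℝ≥0∞, Measurable W ∧ (∀ x, W x ≠ 0) ∧ (∀ x, W x ≠ ∞) ∧
      ∀ᵐ x ∂(volume : Measure ℝ), ENNReal.ofReal (w x) = W x := by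
  have hm : AEMeasurable (fun x => ENNReal.ofReal (w x)) volume :=
    hw.1.aestronglyMeasurable.aemeasurable.ennreal_ofReal
  classical
  let B := hm.mk (fun x => ENNReal.ofReal (w x))
  have hB : Measurable B := hm.measurable_mk
  have hset : MeasurableSet {x | B x = 0 ∨ B x = ∞} :=
    (measurableSet_eq_fun hB measurable_const).union (measurableSet_eq_fun hB measurable_const)
  refine ⟨fun x => if B x = 0 ∨ B x = ∞ then 1 else B x,
    Measurable.ite hset measurable_const hB, fun x => ?_, fun x => ?_, ?_⟩
  · dsimp only
    split_ifs with h
    · simp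
    · exact fun h' => h (Or.inl h')
  · dsimp only
    split_ifs with h
    · simp
    · exact fun h' => h (Or.inr h')
  · filter_upwards [hm.ae_eq_mk, hw.2] with x hx hpos
    have h1 : B x ≠ 0 := by
      simp only [B, ← hx]
      simpa using hpos
    have h2 : B x ≠ ∞ := by simp [B, ← hx]
    simp only [h1, h2, or_self, if_false]
    exact hx

theorem essSup_enorm_rpow {s : ℝ} (hs : 0 < s) (f : ℝ → ℂ) :
    essSup (fun x => ‖f x‖ₑ ^ s) volume ^ (1 / s) = essSup (fun x => ‖f x‖ₑ) volume := by
  have h1 := OrderIso.essSup_apply (fun x => ‖f x‖ₑ) volume (ENNReal.orderIsoRpow s hs)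
  simp only [ENNReal.orderIsoRpow_apply] at h1
  rw [← h1, ← ENNReal.rpow_mul, mul_one_div_cancel hs.ne', ENNReal.rpow_one]

theorem eLpNorm_weightMeasure_eq_powerNorm {s : ℝ≥0} {q : ℝ≥0∞} (hs : 1 ≤ s)
    (hsq : (s : ℝ≥0∞) < q) {w : ℝ → ℝ} (hw_one : q = ∞ → ∀ x, w x = 1) {W : ℝ → ℝ≥0∞}
    (hW : Measurable W) (hwW : ∀ᵐ x ∂(volume : Measure ℝ), ENNReal.ofReal (w x) = W x) {f : ℝ → ℂ}
    (hf : Measurable f) :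
    eLpNorm f q (weightMeasure w) =
      powerNorm (1 / (s : ℝ)) (q⁻¹).toReal W (fun x => ‖f x‖ₑ ^ (s : ℝ)) := by
  have hs0 : (0 : ℝ) < s := by exact_mod_cast zero_lt_one.trans_le hs
  have hq0 : q ≠ 0 := (bot_le.trans_lt hsq).ne'
  by_cases hq : q = ∞
  · subst hq
    have h1 : weightMeasure w = volume := by
      rw [weightMeasure]
      simp [hw_one rfl]
    rw [h1, eLpNorm_exponent_top, eLpNormEssSup, powerNorm, if_pos (by simp),
      essSup_enorm_rpow hs0]
  · have hqr : 0 < q.toReal := ENNReal.toReal_pos hq0 hq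
    rw [eLpNorm_eq_lintegral_rpow_enorm_toReal hq0 hq, weightMeasure, withDensity_congr_ae hwW,
      lintegral_withDensity_eq_lintegral_mul _ hW (by fun_prop), powerNorm, ENNReal.toReal_inv,
      if_neg (inv_pos.2 hqr).ne', one_div]
    congr 1
    refine lintegral_congr fun x => ?_
    rw [Pi.mul_apply, mul_comm, ← ENNReal.rpow_mul]
    congr 2
    field_simp

theorem toReal_div_sub_eq {s : ℝ≥0} {q : ℝ≥0∞} (hs : 1 ≤ s) (hsq : (s : ℝ≥0∞) < q) :
    ((s : ℝ≥0∞) / (q - s)).toReal = (q⁻¹).toReal / (1 / (s : ℝ) - (q⁻¹).toReal) := by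
  have hs0 : (0 : ℝ) < s := by exact_mod_cast zero_lt_one.trans_le hs
  by_cases hq : q = ∞
  · subst hq
    simp
  · lift q to ℝ≥0 using hq
    have h1 : s < q := by exact_mod_cast hsq
    have h2 : (s : ℝ) < q := by exact_mod_cast h1
    have hq0 : (0 : ℝ) < q := hs0.trans h2
    rw [ENNReal.toReal_div, ENNReal.toReal_sub_of_le hsq.le (by simp), ENNReal.toReal_inv]
    simp only [ENNReal.coe_toReal]
    have h3 : (q : ℝ) - s ≠ 0 := (sub_pos.2 h2).ne'
    field_simp

theorem ofReal_rpow_toReal_eq_dualWeight {s : ℝ≥0} {q : ℝ≥0∞} (hs : 1 ≤ s)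
    (hsq : (s : ℝ≥0∞) < q) {w : ℝ → ℝ} {W : ℝ → ℝ≥0∞} {x : ℝ} (hx : 0 < w x)
    (hwW : ENNReal.ofReal (w x) = W x) :
    ENNReal.ofReal (w x ^ (-((s : ℝ≥0∞) / (q - (s : ℝ≥0∞))).toReal)) =
      dualWeight (1 / (s : ℝ)) (q⁻¹).toReal W x := by
  rw [← ENNReal.ofReal_rpow_of_pos hx, hwW, toReal_div_sub_eq hs hsq, dualWeight]

variable {n : ℕ} {s : Fin n → ℝ≥0} {q : Fin n → ℝ≥0∞} {q₀ : ℝ≥0∞} {w : Fin n → ℝ → ℝ}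
  {W : Fin n → ℝ → ℝ≥0∞}

theorem toReal_inv_eq_sum (hq0 : ∀ j, q j ≠ 0) (hq : q₀⁻¹ = ∑ j, (q j)⁻¹) :
    (q₀⁻¹).toReal = ∑ j, ((q j)⁻¹).toReal := by
  rw [hq, ENNReal.toReal_sum fun j _ => ENNReal.inv_ne_top.2 (hq0 j)]

theorem ofReal_productWeight_eq (hq0 : ∀ j, q j ≠ 0) (hq : q₀⁻¹ = ∑ j, (q j)⁻¹) {x : ℝ}
    (hx : ∀ j, 0 < w j x) (hwW : ∀ j, ENNReal.ofReal (w j x) = W j x) :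
    ENNReal.ofReal (productWeight q q₀ w x) = prodWeight (fun j => ((q j)⁻¹).toReal) W x := by
  rw [productWeight, prodWeight,
    ENNReal.ofReal_prod_of_nonneg fun j _ => Real.rpow_nonneg (hx j).le _]
  refine Finset.prod_congr rfl fun j _ => ?_
  rw [← ENNReal.ofReal_rpow_of_pos (hx j), hwW, ← toReal_inv_eq_sum hq0 hq, ENNReal.toReal_inv q₀,
    div_inv_eq_mul, div_eq_mul_inv, ENNReal.toReal_mul, mul_comm]

theorem isVectorWeightClass_iff (hs : ∀ j, 1 ≤ s j) (hsq : ∀ j, (s j : ℝ≥0∞) < q j)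
    (hq : q₀⁻¹ = ∑ j, (q j)⁻¹) (hw : ∀ j, IsWeight (w j))
    (hwW : ∀ j, ∀ᵐ x ∂(volume : Measure ℝ), ENNReal.ofReal (w j x) = W j x) :
    IsVectorWeightClass s q q₀ w ↔ ∃ K : ℝ≥0∞, K ≠ ∞ ∧ ∀ a b, a < b →
      weightCharacteristic (fun j => 1 / (s j : ℝ)) (fun j => ((q j)⁻¹).toReal) W a b ≤ K := by
  have hq0 : ∀ j, q j ≠ 0 := fun j => (bot_le.trans_lt (hsq j)).ne'
  have h1 : vectorWeightConst s q q₀ w = ⨆ (a : ℝ) (b : ℝ) (_ : a < b),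
      weightCharacteristic (fun j => 1 / (s j : ℝ)) (fun j => ((q j)⁻¹).toReal) W a b := by
    have hpos : ∀ᵐ x ∂(volume : Measure ℝ), ∀ j, 0 < w j x := ae_all_iff.2 fun j => (hw j).2
    have hall : ∀ᵐ x ∂(volume : Measure ℝ), ∀ j, ENNReal.ofReal (w j x) = W j x :=
      ae_all_iff.2 hwW
    rw [vectorWeightConst]
    refine iSup_congr fun a => iSup_congr fun b => iSup_congr fun _ => ?_
    rw [weightCharacteristic, toReal_inv_eq_sum hq0 hq]
    congr 1
    · congr 1
      refine laverage_congr (ae_restrict_of_ae ?_)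
      filter_upwards [hpos, hall] with x h2 h3 using ofReal_productWeight_eq hq0 hq h2 h3
    · refine Finset.prod_congr rfl fun j _ => ?_
      congr 1
      refine laverage_congr (ae_restrict_of_ae ?_)
      filter_upwards [hpos, hall] with x h2 h3 using
        ofReal_rpow_toReal_eq_dualWeight (hs j) (hsq j) (h2 j) (h3 j)
  rw [IsVectorWeightClass, h1]
  constructor
  · intro h
    exact ⟨_, h.ne, fun a b hab => le_iSup_of_le a (le_iSup_of_le b (le_iSup_of_le hab le_rfl))⟩
  · rintro ⟨K, hK, h⟩
    exact (iSup_le fun a => iSup_le fun b => iSup_le fun hab => h a b hab).trans_lt hK.lt_top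

/-- Only averages of the functions enter, so equality holds at every point. -/
theorem multiMaximal_congr_ae {f g : Fin n → ℝ → ℂ} (h : ∀ j, f j =ᵐ[volume] g j) :
    multiMaximal s f = multiMaximal s g := by
  ext x
  refine iSup_congr fun a => iSup_congr fun b => iSup_congr fun _ =>
    Finset.prod_congr rfl fun j _ => ?_
  congr 1
  refine laverage_congr (ae_restrict_of_ae ?_)
  filter_upwards [h j] with y hy using by rw [hy]

theorem eLpNorm_multiMaximal_eq (hq0 : ∀ j, q j ≠ 0) (hq : q₀⁻¹ = ∑ j, (q j)⁻¹)
    (hq₀ : q₀ ≠ 0) (hq₀t : q₀ ≠ ∞) (hw : ∀ j, IsWeight (w j)) (hW : ∀ j, Measurable (W j))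
    (hwW : ∀ j, ∀ᵐ x ∂(volume : Measure ℝ), ENNReal.ofReal (w j x) = W j x) (f : Fin n → ℝ → ℂ) :
    eLpNorm (multiMaximal s f) q₀ (weightMeasure (productWeight q q₀ w)) =
      (∫⁻ x, prodWeight (fun j => ((q j)⁻¹).toReal) W x *
        (⨆ (a : ℝ) (b : ℝ) (_ : x ∈ Set.Ioo a b), ∏ j, (⨍⁻ y in Set.Ioo a b,
          ‖f j y‖ₑ ^ (s j : ℝ) ∂volume) ^ (1 / (s j : ℝ))) ^ (1 / ∑ j, ((q j)⁻¹).toReal)) ^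
            (∑ j, ((q j)⁻¹).toReal) := by
  have hpos : ∀ᵐ x ∂(volume : Measure ℝ), ∀ j, 0 < w j x := ae_all_iff.2 fun j => (hw j).2
  have hall : ∀ᵐ x ∂(volume : Measure ℝ), ∀ j, ENNReal.ofReal (w j x) = W j x := ae_all_iff.2 hwW
  have h1 : (fun x => ENNReal.ofReal (productWeight q q₀ w x)) =ᵐ[volume]
      prodWeight (fun j => ((q j)⁻¹).toReal) W := by
    filter_upwards [hpos, hall] with x h2 h3 using ofReal_productWeight_eq hq0 hq h2 h3
  have hM : Measurable (multiMaximal s f) := measurable_iSup_Ioo _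
  rw [eLpNorm_eq_lintegral_rpow_enorm_toReal hq₀ hq₀t, weightMeasure, withDensity_congr_ae h1,
    lintegral_withDensity_eq_lintegral_mul _ (measurable_prodWeight hW)
      (by simpa only [enorm_eq_self] using hM.pow_const _), ← toReal_inv_eq_sum hq0 hq,
    ENNReal.toReal_inv, one_div, one_div, inv_inv]
  rfl

theorem multiMaximal_le_prod_essSup (hs : ∀ j, 0 < s j) (f : Fin n → ℝ → ℂ) (x : ℝ) :
    multiMaximal s f x ≤ ∏ j, essSup (fun y => ‖f j y‖ₑ) volume := by
  refine iSup_le fun a => iSup_le fun b => iSup_le fun _ => Finset.prod_le_prod' fun j _ => ?_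
  rw [← essSup_enorm_rpow (s := s j) (by exact_mod_cast hs j)]
  gcongr
  exact (laverage_le_essSup _).trans (essSup_mono_measure' Measure.restrict_le_self)

theorem eLpNorm_multiMaximal_le_of_top (hs : ∀ j, 0 < s j) (hw_one : ∀ j x, w j x = 1)
    (hq : ∀ j, q j = ∞) (f : Fin n → ℝ → ℂ) (ν : ℝ → ℝ) :
    eLpNorm (multiMaximal s f) ∞ (weightMeasure ν) ≤
      ∏ j, eLpNorm (f j) (q j) (weightMeasure (w j)) := by
  have h1 : ∀ j, weightMeasure (w j) = volume := fun j => by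
    rw [weightMeasure]
    simp [hw_one j]
  simp only [h1, hq, eLpNorm_exponent_top]
  exact essSup_le_of_ae_le _ (Filter.Eventually.of_forall fun x =>
    multiMaximal_le_prod_essSup hs f x)

theorem weightCharacteristic_zero_right (S : Fin n → ℝ) (W : Fin n → ℝ → ℝ≥0∞) {a b : ℝ}
    (hab : a < b) : weightCharacteristic S (fun _ => 0) W a b = 1 := by
  have : ⨍⁻ x in Set.Ioo a b, (1 : ℝ≥0∞) ∂volume = 1 := by
    rw [setLAverage_eq, setLIntegral_one, ENNReal.div_self (by simp [hab]) (by simp)]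
  simp [weightCharacteristic, dualWeight_zero_right, this]

end translation

/-! ### The equivalence. -/

theorem mainTheorem12 {n : ℕ} (s : Fin n → ℝ≥0) (q : Fin n → ℝ≥0∞) (q₀ : ℝ≥0∞)
    (hs : ∀ j, 1 ≤ s j) (hsq : ∀ j, (s j : ℝ≥0∞) < q j)
    (hq : q₀⁻¹ = ∑ j, (q j)⁻¹)
    (w : Fin n → ℝ → ℝ) (hw : ∀ j, IsWeight (w j))
    (hw_one : ∀ j, q j = ∞ → ∀ x, w j x = 1) :
    (∃ C : ℝ≥0, ∀ f : Fin n → ℝ → ℂ, (∀ j, AEStronglyMeasurable (f j) volume) →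
      eLpNorm (multiMaximal s f) q₀ (weightMeasure (productWeight q q₀ w)) ≤
        (C : ℝ≥0∞) * ∏ j, eLpNorm (f j) (q j) (weightMeasure (w j))) ↔
    IsVectorWeightClass s q q₀ w := by
  have hq0 : ∀ j, q j ≠ 0 := fun j => (bot_le.trans_lt (hsq j)).ne'
  have hs0 : ∀ j, 0 < s j := fun j => zero_lt_one.trans_le (hs j)
  have hs0' : ∀ j, (0 : ℝ) < s j := fun j => by exact_mod_cast hs0 j
  choose W hW hW0 hWt hwW using fun j => exists_measurable_weight (hw j)
  rw [isVectorWeightClass_iff hs hsq hq hw hwW]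
  -- Then every `q j` is infinite and both sides hold outright; `n = 0` falls here too.
  by_cases hq₀t : q₀ = ∞
  · have hqt : ∀ j, q j = ∞ := fun j => by
      rw [hq₀t, ENNReal.inv_top, eq_comm, Finset.sum_eq_zero_iff] at hq
      exact ENNReal.inv_eq_zero.1 (hq j (Finset.mem_univ j))
    refine iff_of_true ⟨1, fun f _ => ?_⟩ ⟨1, by simp, fun a b hab => ?_⟩
    · rw [hq₀t, ENNReal.coe_one, one_mul]
      exact eLpNorm_multiMaximal_le_of_top hs0 (fun j => hw_one j (hqt j)) hqt f _
    · simp only [hqt, ENNReal.inv_top, ENNReal.toReal_zero]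
      exact (weightCharacteristic_zero_right _ _ hab).le
  have hq₀ : q₀ ≠ 0 := by
    rw [← ENNReal.inv_ne_top, hq]
    exact ENNReal.sum_ne_top.2 fun j _ => ENNReal.inv_ne_top.2 (hq0 j)
  have hR : 0 < ∑ j, ((q j)⁻¹).toReal := by
    rw [← toReal_inv_eq_sum hq0 hq, ENNReal.toReal_inv]
    exact inv_pos.2 (ENNReal.toReal_pos hq₀ hq₀t)
  have hr : ∀ j, 0 ≤ ((q j)⁻¹).toReal := fun j => ENNReal.toReal_nonneg
  have hrS : ∀ j, ((q j)⁻¹).toReal < 1 / (s j : ℝ) := fun j => by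
    have h1 : (q j)⁻¹ < (s j : ℝ≥0∞)⁻¹ := ENNReal.inv_lt_inv.2 (hsq j)
    have h2 := (ENNReal.toReal_lt_toReal (ENNReal.inv_ne_top.2 (hq0 j))
      (ENNReal.inv_ne_top.2 (by simpa using (hs0 j).ne'))).2 h1
    simpa [ENNReal.toReal_inv] using h2
  constructor
  · rintro ⟨C, hC⟩
    refine ⟨C, by simp, fun a b hab =>
      weightCharacteristic_le_of_maximal_le hW hW0 hWt hr hrS hR (fun g hg hgt => ?_) hab⟩
    let f : Fin n → ℝ → ℂ := fun j x => (((g j x ^ (1 / (s j : ℝ))).toReal : ℝ) : ℂ)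
    have hf : ∀ j, Measurable (f j) := fun j =>
      Complex.measurable_ofReal.comp ((hg j).pow_const _).ennreal_toReal
    have hfg : ∀ j x, ‖f j x‖ₑ ^ (s j : ℝ) = g j x := fun j x => by
      have h1 : ‖f j x‖ₑ = g j x ^ (1 / (s j : ℝ)) := by
        simp only [f]
        rw [← ofReal_norm, Complex.norm_real, Real.norm_of_nonneg ENNReal.toReal_nonneg,
          ENNReal.ofReal_toReal (ENNReal.rpow_ne_top_of_nonneg (by positivity) (hgt j x))]
      rw [h1, ← ENNReal.rpow_mul, one_div_mul_cancel (hs0' j).ne', ENNReal.rpow_one]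
    have h1 := hC f fun j => (hf j).aestronglyMeasurable
    have h2 : ∀ j, eLpNorm (f j) (q j) (weightMeasure (w j)) =
        powerNorm (1 / (s j : ℝ)) ((q j)⁻¹).toReal (W j) (g j) := fun j => by
      rw [eLpNorm_weightMeasure_eq_powerNorm (hs j) (hsq j) (hw_one j) (hW j) (hwW j) (hf j)]
      simp only [hfg]
    rw [eLpNorm_multiMaximal_eq hq0 hq hq₀ hq₀t hw hW hwW] at h1
    simpa only [h2, hfg] using h1
  · rintro ⟨K, hKt, hK⟩
    obtain ⟨C, hC, h⟩ := exists_multilinear_maximal_le hW hW0 hWt hr hrS hR hKt hK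
    refine ⟨C.toNNReal, fun f hf => ?_⟩
    -- Absolute continuity lets measurable representatives replace the `f j` in the weighted norms.
    have hac : ∀ j, weightMeasure (w j) ≪ volume := fun j => withDensity_absolutelyContinuous _ _
    have hmk : ∀ j, Measurable ((hf j).mk (f j)) := fun j => (hf j).stronglyMeasurable_mk.measurable
    have hnorm : ∀ j, eLpNorm (f j) (q j) (weightMeasure (w j)) =
        powerNorm (1 / (s j : ℝ)) ((q j)⁻¹).toReal (W j)
          (fun x => ‖(hf j).mk (f j) x‖ₑ ^ (s j : ℝ)) := fun j => by
      rw [eLpNorm_congr_ae ((hac j).ae_eq (hf j).ae_eq_mk),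
        eLpNorm_weightMeasure_eq_powerNorm (hs j) (hsq j) (hw_one j) (hW j) (hwW j) (hmk j)]
    rw [multiMaximal_congr_ae fun j => (hf j).ae_eq_mk, ENNReal.coe_toNNReal hC,
      eLpNorm_multiMaximal_eq hq0 hq hq₀ hq₀t hw hW hwW, Finset.prod_congr rfl fun j _ => hnorm j]
    exact h _ fun j => (hmk j).enorm.pow_const _
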